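/- Let $n\ge 1$ be an integer, $p>1$ a real number and $\kappa,\kappa_0\in[1,\infty]$. There is a constant $K=K(n,p,\kappa,\kappa_0)\ge 1$ such that the following holds. Let $M$ be a compact connected smooth $n$-manifold without boundary, let $F$ and $F_0$ be Finsler metrics on $M$ (nonnegative, smooth off the zero section, positively $1$-homogeneous and strongly convex on each tangent space, not necessarily reversible) with reversibility constants $\sup_{v\ne 0}F(v)/F(-v)=\kappa$ and $\sup_{v\neq 0}F_0(v)/F_0(-v)=\kappa_0$, and suppose that $F$ and $F_0$ are $C$-bi-Lipschitz for some $C>1$, that is, $$C^{-1}F_0(x,v)\le F(x,v)\le C\,F_0(x,v)\qquad\text{for all }(x,v)\in TM .$$ Then $$C^{-K}\le \frac{\lambda_{1,p}(M,F)}{\lambda_{1,p}(M,F_0)}\le C^{K}$$ (in particular both eigenvalues are positive). Here $\lambda_{1,p}(M,F)$ is the first eigenvalue of the Finsler $p$-Laplacian, $$\lambda_{1,p}(M,F)=\inf\left\{\frac{\int_M F(\nabla f)^p\,d\mathfrak m_F}{\int_M|f|^p\,d\mathfrak m_F}\;:\; f\in W^{1,p}(M)\setminus\{0\},\ \int_M|f|^{p-2}f\,d\mathfrak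 m_F=0\right\},$$ where $\mathfrak m_F$ is the Busemann--Hausdorff measure of $F$, given in local coordinates by $\frac{\omega_n}{\mathrm{Vol}\{v\in T_xM:F(x,v)<1\}}\,dx^1\cdots dx^n$ with $\omega_n$ the volume of the Euclidean unit ball, $W^{1,p}(M)$ is the completion of $C^\infty(M)$ in the Sobolev norm, and $\nabla f(x)$ is the Legendre transform of $df(x)$, i.e. the maximizer of $v\mapsto df(x)(v)-\tfrac12F(x,v)^2$ on $T_xM$. -/

import Mathlib

open scoped Manifold ContDiff ENNReal Topology
open MeasureTheory Filter

noncomputable section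

/-- A Finsler metric on an `n`-dimensional smooth manifold `M` (without boundary): a nonnegative
function on the tangent bundle, smooth off the zero section, positively `1`-homogeneous, and
strongly convex on each tangent space. -/
structure FinslerMetric (n : ℕ) (M : Type*) [TopologicalSpace M]
    [ChartedSpace (EuclideanSpace ℝ (Fin n)) M] [IsManifold (𝓡 n) ∞ M] where
  toFun : TangentBundle (𝓡 n) M → ℝ
  nonneg : ∀ v, 0 ≤ toFun v
  smooth : ContMDiffOn (𝓡 n).tangent 𝓘(ℝ, ℝ) ∞ toFun {v | v.2 ≠ 0}
  homogeneous : ∀ (x : M) (v : TangentSpace (𝓡 n) x) (c : ℝ), 0 ≤ c →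
    toFun ⟨x, c • v⟩ = c * toFun ⟨x, v⟩
  /-- The Hessian of `F² / 2` along the fibre `T_x M` (a linear copy of `ℝⁿ`) is positive definite
  at every nonzero vector. -/
  strongly_convex : ∀ (x : M) (v w : EuclideanSpace ℝ (Fin n)), v ≠ 0 → w ≠ 0 →
    0 < iteratedFDeriv ℝ 2
      (fun u : EuclideanSpace ℝ (Fin n) => (1 / 2 : ℝ) * toFun ⟨x, u⟩ ^ 2) v ![w, w]

/-- The differential of a real function at `x`, as a covector. -/
def differential {n : ℕ} {M : Type*} [TopologicalSpace M]
    [ChartedSpace (EuclideanSpace ℝ (Fin n)) M]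
    (u : M → ℝ) (x : M) : TangentSpace (𝓡 n) x →L[ℝ] ℝ :=
  mfderiv (𝓡 n) 𝓘(ℝ, ℝ) u x

namespace FinslerMetric

section Fibrewise

variable {n : ℕ} {M : Type*} [TopologicalSpace M]
  [ChartedSpace (EuclideanSpace ℝ (Fin n)) M] [IsManifold (𝓡 n) ∞ M]

instance : CoeFun (FinslerMetric n M) (fun _ => TangentBundle (𝓡 n) M → ℝ) := ⟨toFun⟩

/-- The reversibility constant `κ_F = sup F(v) / F(-v) ∈ [1, ∞]`. -/
def reversibility (F : FinslerMetric n M) : ℝ≥0∞ :=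
  ⨆ (x : M) (v : TangentSpace (𝓡 n) x) (_ : v ≠ 0), ENNReal.ofReal (F ⟨x, v⟩ / F ⟨x, -v⟩)

/-- The dual metric `F^*(α) = sup {α(v) : F(v) ≤ 1}` on the cotangent space at `x`. -/
def dual (F : FinslerMetric n M) (x : M) (α : TangentSpace (𝓡 n) x →L[ℝ] ℝ) : ℝ :=
  sSup {r : ℝ | ∃ v : TangentSpace (𝓡 n) x, F ⟨x, v⟩ ≤ 1 ∧ α v = r}

/-- The Legendre transform `J^*(x, α)`: the (unique) maximizer of `v ↦ α(v) - F(x, v)² / 2`. -/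
def legendre (F : FinslerMetric n M) (x : M) (α : TangentSpace (𝓡 n) x →L[ℝ] ℝ) :
    TangentSpace (𝓡 n) x :=
  Classical.epsilon fun v => ∀ w : TangentSpace (𝓡 n) x,
    α w - (1 / 2) * F ⟨x, w⟩ ^ 2 ≤ α v - (1 / 2) * F ⟨x, v⟩ ^ 2

/-- `F` and `F₀` are `C`-bi-Lipschitz. -/
def BiLipschitz (C : ℝ) (F F₀ : FinslerMetric n M) : Prop :=
  1 < C ∧ ∀ v : TangentBundle (𝓡 n) M, C⁻¹ * F₀ v ≤ F v ∧ F v ≤ C * F₀ v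

/-- The Busemann–Hausdorff density `ω_n / Vol {v : F(x, v) < 1}` in the chart `e`, at the point
of the chart with coordinates `y`; tangent vectors at `e⁻¹ y` are written in the
coordinates of `e` through the derivative of `e⁻¹`. -/
def bhDensity (F : FinslerMetric n M)
    (e : OpenPartialHomeomorph M (EuclideanSpace ℝ (Fin n))) (y : EuclideanSpace ℝ (Fin n)) :
    ℝ≥0∞ :=
  volume (Metric.ball (0 : EuclideanSpace ℝ (Fin n)) 1) /
    volume {v : EuclideanSpace ℝ (Fin n) |
      F ⟨e.symm y, mfderiv (𝓡 n) (𝓡 n) e.symm y v⟩ < 1}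

end Fibrewise

section Measures

variable {n : ℕ} {M : Type*} [TopologicalSpace M]
  [ChartedSpace (EuclideanSpace ℝ (Fin n)) M] [IsManifold (𝓡 n) ∞ M] [MeasurableSpace M]

/-- The Busemann–Hausdorff measure on the domain of the chart `e` (zero outside the domain). -/
def bhChartMeasure (F : FinslerMetric n M)
    (e : OpenPartialHomeomorph M (EuclideanSpace ℝ (Fin n))) : Measure M :=
  ((volume.restrict e.target).withDensity (F.bhDensity e)).map e.symm

/-- The Busemann–Hausdorff measure of `(M, F)`. The measures on the chart domains agree on overlaps,
so on a manifold with countable base their supremum is the measure obtained by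
glueing them: the only measure that restricts to `bhChartMeasure F e` on each chart domain. -/
def bhMeasure (F : FinslerMetric n M) : Measure M :=
  ⨆ e ∈ atlas (EuclideanSpace ℝ (Fin n)) M, F.bhChartMeasure e

/-- `(f, α)` is an element of `W^{1,p}(M)`, the completion of `C^∞(M)` for the Sobolev norm (on a
compact manifold): `f` is the limit in `L^p` of smooth functions `u k` whose differentials converge
in `L^p` to the covector field `α`, which is the weak differential of `f`. No separate
measurability of `α` is needed: along a subsequence, `α` is the almost everywhere limit of the
continuous fields `d(u k)`. -/
def IsSobolev (F : FinslerMetric n M) (μ : Measure M) (p : ℝ) (f : M → ℝ)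
    (α : ∀ x : M, TangentSpace (𝓡 n) x →L[ℝ] ℝ) : Prop :=
  MemLp f (ENNReal.ofReal p) μ ∧
  ∃ u : ℕ → M → ℝ,
    (∀ k, ContMDiff (𝓡 n) 𝓘(ℝ, ℝ) ∞ (u k)) ∧
    Tendsto (fun k => eLpNorm (fun x => f x - u k x) (ENNReal.ofReal p) μ) atTop (𝓝 0) ∧
    (∀ k, MemLp (fun x => F.dual x (α x - differential (u k) x)) (ENNReal.ofReal p) μ) ∧
    Tendsto (fun k => eLpNorm (fun x => F.dual x (α x - differential (u k) x))
      (ENNReal.ofReal p) μ) atTop (𝓝 0)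

/-- The energy `E(f) = ∫ F(∇f)^p dμ / ∫ |f|^p dμ`, where `∇f = J^*(df)` and `α = df`. -/
def energy (F : FinslerMetric n M) (μ : Measure M) (p : ℝ) (f : M → ℝ)
    (α : ∀ x : M, TangentSpace (𝓡 n) x →L[ℝ] ℝ) : ℝ :=
  (∫ x, F ⟨x, F.legendre x (α x)⟩ ^ p ∂μ) / (∫ x, |f x| ^ p ∂μ)

/-- The first (closed) eigenvalue of the Finsler `p`-Laplacian with respect to the measure `μ`:
the infimum of `E(f)` over the nonzero `f ∈ W^{1,p}(M)` with `∫ |f|^{p-2} f dμ = 0`. -/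
def firstEigenvalueWith (F : FinslerMetric n M) (μ : Measure M) (p : ℝ) : ℝ :=
  sInf {r : ℝ | ∃ (f : M → ℝ) (α : ∀ x : M, TangentSpace (𝓡 n) x →L[ℝ] ℝ),
    F.IsSobolev μ p f α ∧ ¬ (f =ᵐ[μ] 0) ∧ (∫ x, |f x| ^ (p - 2) * f x ∂μ) = 0 ∧
    r = F.energy μ p f α}

/-- `λ_{1,p}(M, F)`, with the Busemann–Hausdorff measure of `F` as base measure. -/
def firstEigenvalue (F : FinslerMetric n M) (p : ℝ) : ℝ :=
  F.firstEigenvalueWith F.bhMeasure p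

end Measures

end FinslerMetric

end

section Calculus

variable {E : Type*} [NormedAddCommGroup E] [NormedSpace ℝ E]

theorem fderiv_apply_eq_zero_of_eq_zero_on_ray {g : E → ℝ} {v : E}
    (hg : ∀ s : ℝ, 0 ≤ s → g (s • v) = 0) {t : ℝ} (ht : 0 < t) : fderiv ℝ g (t • v) v = 0 := by
  by_cases hd : DifferentiableAt ℝ g (t • v)
  · have h1 : HasDerivAt (fun s : ℝ => s • v) v t := by
      simpa using (hasDerivAt_id t).smul_const v
    have h2 : HasDerivAt (fun s : ℝ => g (s • v)) (fderiv ℝ g (t • v) v) t :=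
      HasFDerivAt.comp_hasDerivAt t hd.hasFDerivAt h1
    have h3 : (fun s : ℝ => g (s • v)) =ᶠ[𝓝 t] fun _ => (0 : ℝ) := by
      filter_upwards [lt_mem_nhds ht] with s hs using hg s hs.le
    exact h2.unique ((hasDerivAt_const t (0 : ℝ)).congr_of_eventuallyEq h3)
  · simp [fderiv_zero_of_not_differentiableAt hd]

theorem iteratedFDeriv_two_eq_zero_of_eq_zero_on_ray {g : E → ℝ} {v : E}
    (hg : ∀ s : ℝ, 0 ≤ s → g (s • v) = 0) : iteratedFDeriv ℝ 2 g v ![v, v] = 0 := by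
  rw [iteratedFDeriv_two_apply]
  simp only [Matrix.cons_val_zero, Matrix.cons_val_one]
  by_cases hd : DifferentiableAt ℝ (fderiv ℝ g) v
  · have h1 : HasDerivAt (fun s : ℝ => s • v) v 1 := by
      simpa using (hasDerivAt_id (1 : ℝ)).smul_const v
    have hd' : HasFDerivAt (fderiv ℝ g) (fderiv ℝ (fderiv ℝ g) v) ((1 : ℝ) • v) := by
      simpa using hd.hasFDerivAt
    have h2 : HasDerivAt (fun s : ℝ => fderiv ℝ g (s • v)) (fderiv ℝ (fderiv ℝ g) v v) 1 :=
      hd'.comp_hasDerivAt 1 h1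
    have h3 : HasDerivAt (fun s : ℝ => fderiv ℝ g (s • v) v) (fderiv ℝ (fderiv ℝ g) v v v) 1 := by
      simpa using h2.clm_apply (hasDerivAt_const (1 : ℝ) v)
    have h4 : (fun s : ℝ => fderiv ℝ g (s • v) v) =ᶠ[𝓝 1] fun _ => (0 : ℝ) := by
      filter_upwards [lt_mem_nhds (zero_lt_one' ℝ)] with s hs
        using fderiv_apply_eq_zero_of_eq_zero_on_ray hg hs
    exact h3.unique ((hasDerivAt_const (1 : ℝ) (0 : ℝ)).congr_of_eventuallyEq h4)
  · simp [fderiv_zero_of_not_differentiableAt hd]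

/-- A family of positively homogeneous functions, jointly continuous and positive off zero, is
uniformly comparable to the norm over a compact parameter set. -/
theorem exists_norm_bounds_of_homogeneous [FiniteDimensional ℝ E] {Y : Type*} [TopologicalSpace Y]
    {K : Set Y} (hK : IsCompact K) {G : Y → E → ℝ}
    (hcont : ContinuousOn (fun q : Y × E => G q.1 q.2) (K ×ˢ {0}ᶜ))
    (hpos : ∀ y ∈ K, ∀ v, v ≠ 0 → 0 < G y v)
    (hhom : ∀ y ∈ K, ∀ v, ∀ c : ℝ, 0 ≤ c → G y (c • v) = c * G y v) :
    ∃ a b : ℝ, 0 < a ∧ 0 < b ∧ ∀ y ∈ K, ∀ v, a * ‖v‖ ≤ G y v ∧ G y v ≤ b * ‖v‖ := by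
  have hS : IsCompact (K ×ˢ Metric.sphere (0 : E) 1) := hK.prod (isCompact_sphere 0 1)
  have hc : ContinuousOn (fun q : Y × E => G q.1 q.2) (K ×ˢ Metric.sphere (0 : E) 1) :=
    hcont.mono (Set.prod_mono_right fun v hv => by
      rintro rfl
      simp at hv)
  have key : ∃ a b : ℝ, 0 < a ∧ 0 < b ∧ ∀ y ∈ K, ∀ v ∈ Metric.sphere (0 : E) 1,
      a ≤ G y v ∧ G y v ≤ b := by
    rcases (K ×ˢ Metric.sphere (0 : E) 1).eq_empty_or_nonempty with h | h
    · refine ⟨1, 1, one_pos, one_pos, fun y hy v hv => ?_⟩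
      have : (y, v) ∈ K ×ˢ Metric.sphere (0 : E) 1 := ⟨hy, hv⟩
      simp [h] at this
    · obtain ⟨q, hq, hmin⟩ := hS.exists_isMinOn h hc
      obtain ⟨r, hr, hmax⟩ := hS.exists_isMaxOn h hc
      have hne : ∀ q ∈ K ×ˢ Metric.sphere (0 : E) 1, 0 < G q.1 q.2 := fun q hq =>
        hpos _ hq.1 _ (by
          intro h0
          have := hq.2
          simp [h0] at this)
      exact ⟨_, _, hne q hq, hne r hr, fun y hy v hv =>
        ⟨hmin (show (y, v) ∈ _ from ⟨hy, hv⟩), hmax (show (y, v) ∈ _ from ⟨hy, hv⟩)⟩⟩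
  obtain ⟨a, b, ha, hb, hab⟩ := key
  refine ⟨a, b, ha, hb, fun y hy v => ?_⟩
  rcases eq_or_ne v 0 with rfl | hv
  · have := hhom y hy 0 0 le_rfl
    simp only [zero_mul, zero_smul] at this
    simp [this]
  · have hv' : 0 < ‖v‖ := norm_pos_iff.2 hv
    have h1 := hab y hy (‖v‖⁻¹ • v) (by simp [norm_smul, hv'.ne'])
    rw [hhom y hy v _ (by positivity)] at h1
    have h2 : G y v = ‖v‖ * (‖v‖⁻¹ * G y v) := by field_simp
    rw [h2]
    constructor <;> nlinarith [h1.1, h1.2]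

end Calculus

namespace FinslerMetric

section TangentCoord

variable {n : ℕ} {M : Type*} [TopologicalSpace M] [ChartedSpace (EuclideanSpace ℝ (Fin n)) M]

/-- The tangent space at `x`, identified with the model space. -/
def tangentCoord (x : M) : TangentSpace (𝓡 n) x ≃L[ℝ] EuclideanSpace ℝ (Fin n) :=
  ContinuousLinearEquiv.refl ℝ (EuclideanSpace ℝ (Fin n))

theorem apply_le_norm (x : M) (α : TangentSpace (𝓡 n) x →L[ℝ] ℝ) (v : TangentSpace (𝓡 n) x) :
    α v ≤ ‖α ∘L (tangentCoord x).symm.toContinuousLinearMap‖ * ‖tangentCoord x v‖ := by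
  have := (α ∘L (tangentCoord x).symm.toContinuousLinearMap).le_opNorm (tangentCoord x v)
  simp only [ContinuousLinearMap.comp_apply, ContinuousLinearEquiv.coe_coe,
    ContinuousLinearEquiv.symm_apply_apply] at this
  exact (le_abs_self _).trans this

end TangentCoord

section Fibre

variable {n : ℕ} {M : Type*} [TopologicalSpace M]
  [ChartedSpace (EuclideanSpace ℝ (Fin n)) M] [IsManifold (𝓡 n) ∞ M]
  (F F₀ : FinslerMetric n M)

theorem map_zero (x : M) : F ⟨x, 0⟩ = 0 := by
  have := F.homogeneous x 0 0 le_rfl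
  simpa using this

theorem pos (x : M) {v : TangentSpace (𝓡 n) x} (hv : v ≠ 0) : 0 < F ⟨x, v⟩ := by
  refine lt_of_le_of_ne (F.nonneg _) fun h0 => ?_
  have h := F.strongly_convex x v v hv hv
  have h2 := iteratedFDeriv_two_eq_zero_of_eq_zero_on_ray
    (g := fun u : EuclideanSpace ℝ (Fin n) => (1 / 2 : ℝ) * F ⟨x, u⟩ ^ 2) (v := v) (by
      intro s hs
      have := F.homogeneous x v s hs
      rw [← h0, mul_zero] at this
      change (1 / 2 : ℝ) * F ⟨x, s • v⟩ ^ 2 = 0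
      rw [this]
      simp)
  exact h.ne' h2

theorem continuousOn_toFun : ContinuousOn F {v | v.2 ≠ 0} := F.smooth.continuousOn

theorem exists_fibre_bounds (x : M) : ∃ a b : ℝ, 0 < a ∧ 0 < b ∧
    ∀ v : TangentSpace (𝓡 n) x,
      a * ‖tangentCoord x v‖ ≤ F ⟨x, v⟩ ∧ F ⟨x, v⟩ ≤ b * ‖tangentCoord x v‖ := by
  have hc : Continuous fun q : Unit × EuclideanSpace ℝ (Fin n) =>
      (⟨x, (tangentCoord x).symm q.2⟩ : TangentBundle (𝓡 n) M) :=
    (FiberBundle.continuous_totalSpaceMk (EuclideanSpace ℝ (Fin n))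
      (TangentSpace (𝓡 n) : M → Type _) x).comp
        ((tangentCoord x).symm.continuous.comp continuous_snd)
  obtain ⟨a, b, ha, hb, h⟩ := exists_norm_bounds_of_homogeneous (isCompact_univ (X := Unit))
    (G := fun _ v => F ⟨x, (tangentCoord x).symm v⟩)
    (F.continuousOn_toFun.comp hc.continuousOn fun q hq =>
      (map_ne_zero_iff _ (tangentCoord x).symm.injective).2 hq.2)
    (fun _ _ v hv => F.pos x ((map_ne_zero_iff _ (tangentCoord x).symm.injective).2 hv))
    (fun _ _ v c hc => by simpa using F.homogeneous x ((tangentCoord x).symm v) c hc)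
  exact ⟨a, b, ha, hb, fun v => by simpa using h () trivial (tangentCoord x v)⟩

theorem continuous_fibre (x : M) :
    Continuous fun v : EuclideanSpace ℝ (Fin n) => F ⟨x, (tangentCoord x).symm v⟩ := by
  have hc : Continuous fun v : EuclideanSpace ℝ (Fin n) =>
      (⟨x, (tangentCoord x).symm v⟩ : TangentBundle (𝓡 n) M) :=
    (FiberBundle.continuous_totalSpaceMk (EuclideanSpace ℝ (Fin n))
      (TangentSpace (𝓡 n) : M → Type _) x).comp (tangentCoord x).symm.continuous
  refine continuous_iff_continuousAt.2 fun v => ?_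
  rcases eq_or_ne v 0 with rfl | hv
  · obtain ⟨a, b, -, -, h⟩ := F.exists_fibre_bounds x
    have h0 : F ⟨x, (tangentCoord x).symm 0⟩ = 0 := by simp [F.map_zero]
    rw [ContinuousAt, h0]
    refine squeeze_zero (g := fun v => b * ‖v‖) (fun v => F.nonneg _)
      (fun v => by simpa using (h ((tangentCoord x).symm v)).2) ?_
    have : Continuous fun v : EuclideanSpace ℝ (Fin n) => b * ‖v‖ := by fun_prop
    simpa using this.tendsto 0
  · exact (F.continuousOn_toFun.comp hc.continuousOn (s := {0}ᶜ) fun q hq =>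
      (map_ne_zero_iff _ (tangentCoord x).symm.injective).2 hq).continuousAt
        (isOpen_compl_singleton.mem_nhds hv)

theorem bddAbove_dual (x : M) (α : TangentSpace (𝓡 n) x →L[ℝ] ℝ) :
    BddAbove {r : ℝ | ∃ v : TangentSpace (𝓡 n) x, F ⟨x, v⟩ ≤ 1 ∧ α v = r} := by
  obtain ⟨a, b, ha, -, h⟩ := F.exists_fibre_bounds x
  refine ⟨‖α ∘L (tangentCoord x).symm.toContinuousLinearMap‖ * a⁻¹, ?_⟩
  rintro r ⟨v, hv, rfl⟩
  have h1 : ‖tangentCoord x v‖ ≤ a⁻¹ := by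
    rw [← one_div, le_div_iff₀ ha, mul_comm]
    exact (h v).1.trans hv
  exact (apply_le_norm x α v).trans (by gcongr)

theorem dual_nonneg (x : M) (α : TangentSpace (𝓡 n) x →L[ℝ] ℝ) : 0 ≤ F.dual x α :=
  le_csSup (F.bddAbove_dual x α) ⟨0, by simp [F.map_zero], by simp⟩

theorem apply_le_dual_mul (x : M) (α : TangentSpace (𝓡 n) x →L[ℝ] ℝ) (v : TangentSpace (𝓡 n) x) :
    α v ≤ F.dual x α * F ⟨x, v⟩ := by
  rcases eq_or_ne v 0 with rfl | hv
  · simp [F.map_zero]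
  · have hp := F.pos x hv
    have h : α ((F ⟨x, v⟩)⁻¹ • v) ≤ F.dual x α := le_csSup (F.bddAbove_dual x α)
      ⟨_, by rw [F.homogeneous x v _ (by positivity), inv_mul_cancel₀ hp.ne'], rfl⟩
    rw [map_smul, smul_eq_mul, inv_mul_le_iff₀ hp] at h
    linarith

theorem dual_le (x : M) (α : TangentSpace (𝓡 n) x →L[ℝ] ℝ) {r : ℝ} (hr : 0 ≤ r)
    (h : ∀ v : TangentSpace (𝓡 n) x, α v ≤ r * F ⟨x, v⟩) : F.dual x α ≤ r := by
  refine csSup_le ⟨0, 0, by simp [F.map_zero], by simp⟩ ?_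
  rintro _ ⟨v, hv, rfl⟩
  exact (h v).trans (mul_le_of_le_one_right hr hv)

theorem dual_zero (x : M) : F.dual x 0 = 0 :=
  le_antisymm (F.dual_le x 0 le_rfl (by simp)) (F.dual_nonneg x 0)

theorem dual_add_le (x : M) (α β : TangentSpace (𝓡 n) x →L[ℝ] ℝ) :
    F.dual x (α + β) ≤ F.dual x α + F.dual x β := by
  refine F.dual_le x _ (add_nonneg (F.dual_nonneg x α) (F.dual_nonneg x β)) fun v => ?_
  have h1 := F.apply_le_dual_mul x α v
  have h2 := F.apply_le_dual_mul x β v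
  rw [add_apply]
  linarith

theorem dual_le_mul_dual {C : ℝ} (hC : 0 ≤ C) (x : M)
    (h : ∀ v : TangentSpace (𝓡 n) x, F₀ ⟨x, v⟩ ≤ C * F ⟨x, v⟩)
    (α : TangentSpace (𝓡 n) x →L[ℝ] ℝ) : F.dual x α ≤ C * F₀.dual x α := by
  refine F.dual_le x α (mul_nonneg hC (F₀.dual_nonneg x α)) fun v => ?_
  calc α v ≤ F₀.dual x α * F₀ ⟨x, v⟩ := F₀.apply_le_dual_mul x α v
    _ ≤ F₀.dual x α * (C * F ⟨x, v⟩) := by gcongr; exacts [F₀.dual_nonneg x α, h v]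
    _ = _ := by ring

theorem dual_neg_le {R : ℝ} (hR : 0 ≤ R) (x : M)
    (h : ∀ v : TangentSpace (𝓡 n) x, F ⟨x, -v⟩ ≤ R * F ⟨x, v⟩)
    (α : TangentSpace (𝓡 n) x →L[ℝ] ℝ) : F.dual x (-α) ≤ R * F.dual x α := by
  refine F.dual_le x _ (mul_nonneg hR (F.dual_nonneg x α)) fun v => ?_
  calc (-α) v = α (-v) := by simp
    _ ≤ F.dual x α * F ⟨x, -v⟩ := F.apply_le_dual_mul x α (-v)
    _ ≤ F.dual x α * (R * F ⟨x, v⟩) := by gcongr; exacts [F.dual_nonneg x α, h v]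
    _ = _ := by ring

theorem exists_reversibility_fibre (x : M) : ∃ R : ℝ, 0 ≤ R ∧
    ∀ v : TangentSpace (𝓡 n) x, F ⟨x, -v⟩ ≤ R * F ⟨x, v⟩ := by
  obtain ⟨a, b, ha, hb, h⟩ := F.exists_fibre_bounds x
  refine ⟨b / a, by positivity, fun v => ?_⟩
  have h1 := (h (-v)).2
  have h2 := (h v).1
  rw [map_neg, norm_neg] at h1
  calc F ⟨x, -v⟩ ≤ b * ‖tangentCoord x v‖ := h1
    _ = b / a * (a * ‖tangentCoord x v‖) := by field_simp
    _ ≤ b / a * F ⟨x, v⟩ := by gcongr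

theorem exists_isMax_legendre (x : M) (α : TangentSpace (𝓡 n) x →L[ℝ] ℝ) :
    ∃ v : TangentSpace (𝓡 n) x, ∀ w : TangentSpace (𝓡 n) x,
      α w - (1 / 2) * F ⟨x, w⟩ ^ 2 ≤ α v - (1 / 2) * F ⟨x, v⟩ ^ 2 := by
  obtain ⟨a, b, ha, -, h⟩ := F.exists_fibre_bounds x
  set L := ‖α ∘L (tangentCoord x).symm.toContinuousLinearMap‖ with hL
  have hL0 : 0 ≤ L := norm_nonneg _
  let g : EuclideanSpace ℝ (Fin n) → ℝ := fun w =>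
    (α ∘L (tangentCoord x).symm.toContinuousLinearMap) w -
      (1 / 2) * F ⟨x, (tangentCoord x).symm w⟩ ^ 2
  have hg : Continuous g := by
    have := F.continuous_fibre x
    fun_prop
  have hr : 0 ≤ 2 * L / a ^ 2 := by positivity
  obtain ⟨v, -, hv⟩ := (isCompact_closedBall (0 : EuclideanSpace ℝ (Fin n))
    (2 * L / a ^ 2)).exists_isMaxOn ⟨0, by simpa using hr⟩ hg.continuousOn
  have hg0 : g 0 = 0 := by simp [g, F.map_zero]
  have hgw : ∀ w : TangentSpace (𝓡 n) x,
      α w - (1 / 2) * F ⟨x, w⟩ ^ 2 = g (tangentCoord x w) := fun w => by simp [g]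
  refine ⟨(tangentCoord x).symm v, fun w => ?_⟩
  rw [hgw, hgw, ContinuousLinearEquiv.apply_symm_apply]
  by_cases hw : tangentCoord x w ∈ Metric.closedBall (0 : EuclideanSpace ℝ (Fin n)) (2 * L / a ^ 2)
  · exact hv hw
  · refine le_trans ?_ (hg0.symm.le.trans (hv (by simpa using hr)))
    rw [← hgw]
    have h1 := apply_le_norm x α w
    have h2 := (h w).1
    rw [mem_closedBall_zero_iff, not_le, div_lt_iff₀ (by positivity)] at hw
    have h3 : (a * ‖tangentCoord x w‖) ^ 2 ≤ F ⟨x, w⟩ ^ 2 := by gcongr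
    have h4 : 0 ≤ ‖tangentCoord x w‖ := norm_nonneg _
    rw [← hL] at h1
    nlinarith

theorem map_legendre (x : M) (α : TangentSpace (𝓡 n) x →L[ℝ] ℝ) :
    F ⟨x, F.legendre x α⟩ = F.dual x α := by
  have hmax : ∀ w : TangentSpace (𝓡 n) x, α w - (1 / 2) * F ⟨x, w⟩ ^ 2 ≤
      α (F.legendre x α) - (1 / 2) * F ⟨x, F.legendre x α⟩ ^ 2 :=
    Classical.epsilon_spec (F.exists_isMax_legendre x α)
  set v := F.legendre x α with hv
  have hray : ∀ (w : TangentSpace (𝓡 n) x) (t : ℝ), 0 ≤ t →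
      t * α w - (1 / 2) * (t * F ⟨x, w⟩) ^ 2 ≤ α v - (1 / 2) * F ⟨x, v⟩ ^ 2 := fun w t ht => by
    simpa [F.homogeneous x w t ht] using hmax (t • w)
  have hF := F.nonneg ⟨x, v⟩
  have hαv : α v = F ⟨x, v⟩ ^ 2 := by
    have h0 := hray v 0 le_rfl
    have h2 := hray v 2 (by norm_num)
    rcases hF.eq_or_lt with h | h
    · rw [← h] at h0 h2 ⊢
      linarith
    · have h3 := hray v (α v / F ⟨x, v⟩ ^ 2) (by
        have : 0 ≤ α v := by nlinarith
        positivity)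
      have h4 : α v / F ⟨x, v⟩ ^ 2 * α v - 1 / 2 * (α v / F ⟨x, v⟩ ^ 2 * F ⟨x, v⟩) ^ 2 =
          (α v) ^ 2 / (2 * F ⟨x, v⟩ ^ 2) := by field_simp; ring
      rw [h4, div_le_iff₀ (by positivity)] at h3
      have h5 : (α v - F ⟨x, v⟩ ^ 2) ^ 2 ≤ 0 := by nlinarith
      nlinarith [pow_eq_zero_iff (two_ne_zero) |>.1 (le_antisymm h5 (sq_nonneg _))]
  apply le_antisymm
  · rcases hF.eq_or_lt with h | h
    · rw [← h]
      exact F.dual_nonneg x α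
    · have h1 := F.apply_le_dual_mul x α v
      rw [hαv, sq] at h1
      exact le_of_mul_le_mul_right h1 h
  · refine F.dual_le x α hF fun w => ?_
    rcases le_or_gt (α w) 0 with h | h
    · exact h.trans (mul_nonneg hF (F.nonneg _))
    · have hw : 0 < F ⟨x, w⟩ := F.pos x (by rintro rfl; simp at h)
      have h3 := hray w (α w / F ⟨x, w⟩ ^ 2) (by positivity)
      have h4 : α w / F ⟨x, w⟩ ^ 2 * α w - 1 / 2 * (α w / F ⟨x, w⟩ ^ 2 * F ⟨x, w⟩) ^ 2 =
          (α w) ^ 2 / (2 * F ⟨x, w⟩ ^ 2) := by field_simp; ring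
      rw [h4, hαv, div_le_iff₀ (by positivity)] at h3
      refine (sq_le_sq₀ h.le (mul_nonneg hF hw.le)).1 ?_
      nlinarith

end Fibre

end FinslerMetric

namespace FinslerMetric

section Chart

variable {n : ℕ} {M : Type*} [TopologicalSpace M]
  [ChartedSpace (EuclideanSpace ℝ (Fin n)) M] [IsManifold (𝓡 n) ∞ M]
  (F : FinslerMetric n M) {e : OpenPartialHomeomorph M (EuclideanSpace ℝ (Fin n))}

local notation "𝔼" => EuclideanSpace ℝ (Fin n)

/-- The differential of the inverse of a chart, as a linear isomorphism. -/
noncomputable def chartEquiv (he : e ∈ atlas 𝔼 M) {y : 𝔼} (hy : y ∈ e.target) :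
    𝔼 ≃L[ℝ] TangentSpace (𝓡 n) (e.symm y) :=
  haveI : IsManifold (𝓡 n) 1 M := IsManifold.of_le (n := ∞) (by simp)
  (mdifferentiable_of_mem_atlas (I := 𝓡 n) he).symm.mfderiv hy

/-- The metric in the coordinates of a chart. -/
noncomputable def inChart (e : OpenPartialHomeomorph M (EuclideanSpace ℝ (Fin n))) (y w : 𝔼) : ℝ :=
  F ⟨e.symm y, mfderiv (𝓡 n) (𝓡 n) e.symm y w⟩

theorem inChart_eq (he : e ∈ atlas 𝔼 M) {y : 𝔼} (hy : y ∈ e.target) (w : 𝔼) :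
    F.inChart e y w = F ⟨e.symm y, chartEquiv he hy w⟩ := rfl

theorem inChart_pos (he : e ∈ atlas 𝔼 M) {y : 𝔼} (hy : y ∈ e.target) {w : 𝔼} (hw : w ≠ 0) :
    0 < F.inChart e y w := by
  rw [F.inChart_eq he hy]
  exact F.pos _ ((map_ne_zero_iff _ (chartEquiv he hy).injective).2 hw)

theorem inChart_smul (he : e ∈ atlas 𝔼 M) {y : 𝔼} (hy : y ∈ e.target) (w : 𝔼) {c : ℝ}
    (hc : 0 ≤ c) : F.inChart e y (c • w) = c * F.inChart e y w := by
  rw [F.inChart_eq he hy, F.inChart_eq he hy, map_smul, F.homogeneous _ _ _ hc]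

theorem continuousOn_inChart (he : e ∈ atlas 𝔼 M) :
    ContinuousOn (fun q : 𝔼 × 𝔼 => F.inChart e q.1 q.2) (e.target ×ˢ {0}ᶜ) := by
  have : IsManifold (𝓡 n) 1 M := IsManifold.of_le (n := ∞) (by simp)
  have h1 : ContMDiffOn (𝓡 n) (𝓡 n) ∞ e.symm e.target :=
    contMDiffOn_symm_of_mem_maximalAtlas (IsManifold.subset_maximalAtlas he)
  have h2 := h1.continuousOn_tangentMapWithin (by simp) e.open_target.uniqueMDiffOn
  have h3 : ContinuousOn (fun q : 𝔼 × 𝔼 => tangentMapWithin (𝓡 n) (𝓡 n) e.symm e.target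
      ((tangentBundleModelSpaceHomeomorph (𝓡 n)).symm q)) (e.target ×ˢ {0}ᶜ) :=
    h2.comp (tangentBundleModelSpaceHomeomorph (𝓡 n)).symm.continuous.continuousOn
      fun q hq => hq.1
  have h4 : ∀ q ∈ e.target ×ˢ ({0}ᶜ : Set 𝔼), tangentMapWithin (𝓡 n) (𝓡 n) e.symm e.target
      ((tangentBundleModelSpaceHomeomorph (𝓡 n)).symm q) =
        (⟨e.symm q.1, mfderiv (𝓡 n) (𝓡 n) e.symm q.1 q.2⟩ : TangentBundle (𝓡 n) M) := by
    intro q hq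
    have : mfderivWithin (𝓡 n) (𝓡 n) e.symm e.target q.1 = mfderiv (𝓡 n) (𝓡 n) e.symm q.1 :=
      mfderivWithin_of_mem_nhds (e.open_target.mem_nhds hq.1)
    rw [← this]
    rfl
  refine F.continuousOn_toFun.comp (h3.congr fun q hq => (h4 q hq).symm) fun q hq => ?_
  exact (map_ne_zero_iff _ (chartEquiv he hq.1).injective).2 hq.2

theorem exists_inChart_bounds (he : e ∈ atlas 𝔼 M) {K : Set 𝔼} (hK : IsCompact K)
    (hKe : K ⊆ e.target) : ∃ a b : ℝ, 0 < a ∧ 0 < b ∧ ∀ y ∈ K, ∀ w,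
      a * ‖w‖ ≤ F.inChart e y w ∧ F.inChart e y w ≤ b * ‖w‖ :=
  exists_norm_bounds_of_homogeneous hK
    ((F.continuousOn_inChart he).mono (Set.prod_mono_left hKe))
    (fun _ hy _ hw => F.inChart_pos he (hKe hy) hw)
    (fun _ hy w _ hc => F.inChart_smul he (hKe hy) w hc)

theorem exists_reversibility [CompactSpace M] : ∃ R : ℝ, 0 ≤ R ∧
    ∀ (x : M) (v : TangentSpace (𝓡 n) x), F ⟨x, -v⟩ ≤ R * F ⟨x, v⟩ := by
  suffices ∃ R : ℝ, 0 ≤ R ∧ ∀ x ∈ (Set.univ : Set M), ∀ v : TangentSpace (𝓡 n) x,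
      F ⟨x, -v⟩ ≤ R * F ⟨x, v⟩ by simpa using this
  refine isCompact_univ.induction_on (p := fun s : Set M => ∃ R : ℝ, 0 ≤ R ∧
    ∀ x ∈ s, ∀ v : TangentSpace (𝓡 n) x, F ⟨x, -v⟩ ≤ R * F ⟨x, v⟩) ⟨0, le_rfl, by simp⟩
    ?_ ?_ ?_
  · rintro s t hst ⟨R, hR, h⟩
    exact ⟨R, hR, fun x hx => h x (hst hx)⟩
  · rintro s t ⟨R, hR, h⟩ ⟨R', hR', h'⟩
    refine ⟨max R R', le_max_of_le_left hR, ?_⟩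
    rintro x (hx | hx) v
    · exact (h x hx v).trans (mul_le_mul_of_nonneg_right (le_max_left _ _) (F.nonneg _))
    · exact (h' x hx v).trans (mul_le_mul_of_nonneg_right (le_max_right _ _) (F.nonneg _))
  · intro x₀ _
    set e := chartAt 𝔼 x₀
    have he : e ∈ atlas 𝔼 M := chart_mem_atlas 𝔼 x₀
    have hx₀ : x₀ ∈ e.source := mem_chart_source 𝔼 x₀
    obtain ⟨r, hr, hball⟩ := Metric.nhds_basis_closedBall.mem_iff.1
      (e.open_target.mem_nhds (e.map_source hx₀))
    obtain ⟨a, b, ha, hb, hab⟩ := F.exists_inChart_bounds he (isCompact_closedBall (e x₀) r) hball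
    refine ⟨e.source ∩ e ⁻¹' Metric.closedBall (e x₀) r, ?_, b / a, by positivity, ?_⟩
    · exact mem_nhdsWithin_of_mem_nhds (Filter.inter_mem (e.open_source.mem_nhds hx₀)
        ((e.continuousAt hx₀).preimage_mem_nhds (Metric.closedBall_mem_nhds _ hr)))
    · rintro x ⟨hx, hxr⟩ v
      obtain ⟨y, hy, hyr, rfl⟩ : ∃ y ∈ e.target, y ∈ Metric.closedBall (e x₀) r ∧ e.symm y = x :=
        ⟨e x, e.map_source hx, hxr, e.left_inv hx⟩
      obtain ⟨w, rfl⟩ := (chartEquiv he hy).surjective v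
      rw [← map_neg, ← F.inChart_eq he hy, ← F.inChart_eq he hy]
      have h1 := (hab y hyr w).1
      have h2 := (hab y hyr (-w)).2
      rw [norm_neg] at h2
      calc F.inChart e y (-w) ≤ b * ‖w‖ := h2
        _ = b / a * (a * ‖w‖) := by field_simp
        _ ≤ b / a * F.inChart e y w := by gcongr

variable {u : M → ℝ}

theorem contDiffOn_comp_symm (he : e ∈ atlas 𝔼 M) (hu : ContMDiff (𝓡 n) 𝓘(ℝ, ℝ) ∞ u) :
    ContDiffOn ℝ ∞ (u ∘ e.symm) e.target := by
  have h1 : ContMDiffOn (𝓡 n) (𝓡 n) ∞ e.symm e.target :=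
    contMDiffOn_symm_of_mem_maximalAtlas (IsManifold.subset_maximalAtlas he)
  exact contMDiffOn_iff_contDiffOn.1 (hu.comp_contMDiffOn h1)

theorem fderiv_comp_symm (he : e ∈ atlas 𝔼 M) (hu : ContMDiff (𝓡 n) 𝓘(ℝ, ℝ) ∞ u) {y : 𝔼}
    (hy : y ∈ e.target) (w : 𝔼) :
    fderiv ℝ (u ∘ e.symm) y w = differential u (e.symm y) (chartEquiv he hy w) := by
  have : IsManifold (𝓡 n) 1 M := IsManifold.of_le (n := ∞) (by simp)
  rw [← mfderiv_eq_fderiv, mfderiv_comp y (hu.mdifferentiableAt (by simp))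
    (mdifferentiableAt_atlas_symm he hy)]
  rfl

theorem dual_differential_eq (he : e ∈ atlas 𝔼 M) (hu : ContMDiff (𝓡 n) 𝓘(ℝ, ℝ) ∞ u)
    {y : 𝔼} (hy : y ∈ e.target) :
    F.dual (e.symm y) (differential u (e.symm y)) =
      sSup ((fun w : Metric.sphere (0 : 𝔼) 1 =>
        fderiv ℝ (u ∘ e.symm) y w / F.inChart e y w) '' Set.univ) := by
  have hne : ∀ w : Metric.sphere (0 : 𝔼) 1, (w : 𝔼) ≠ 0 := fun w => by
    have := w.2
    rintro h
    simp [h] at this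
  have hle : ∀ w : Metric.sphere (0 : 𝔼) 1, fderiv ℝ (u ∘ e.symm) y w / F.inChart e y w ≤
      F.dual (e.symm y) (differential u (e.symm y)) := fun w => by
    rw [div_le_iff₀ (F.inChart_pos he hy (hne w)), fderiv_comp_symm he hu hy]
    exact F.apply_le_dual_mul _ _ _
  have hbdd : BddAbove ((fun w : Metric.sphere (0 : 𝔼) 1 =>
        fderiv ℝ (u ∘ e.symm) y w / F.inChart e y w) '' Set.univ) :=
    ⟨_, by rintro _ ⟨w, -, rfl⟩; exact hle w⟩
  apply le_antisymm
  · have key : ∀ w : Metric.sphere (0 : 𝔼) 1, fderiv ℝ (u ∘ e.symm) y w / F.inChart e y w ≤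
      sSup ((fun w : Metric.sphere (0 : 𝔼) 1 =>
        fderiv ℝ (u ∘ e.symm) y w / F.inChart e y w) '' Set.univ) := fun w =>
      le_csSup hbdd ⟨w, trivial, rfl⟩
    refine F.dual_le _ _ ?_ fun v => ?_
    · rcases isEmpty_or_nonempty (Metric.sphere (0 : 𝔼) 1) with h | ⟨⟨w⟩⟩
      · simp [Set.range_eq_empty]
      · have h1 := F.inChart_pos he hy (hne w)
        have h2 := F.inChart_pos he hy (hne (-w))
        rcases le_total 0 (fderiv ℝ (u ∘ e.symm) y w) with h | h
        · exact (div_nonneg h h1.le).trans (key w)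
        · refine le_trans (div_nonneg ?_ h2.le) (key (-w))
          simpa using h
    · obtain ⟨w, rfl⟩ := (chartEquiv he hy).surjective v
      rcases eq_or_ne w 0 with rfl | hw
      · simp [F.map_zero]
      · have hw' : 0 < ‖w‖ := norm_pos_iff.2 hw
        have h1 := key ⟨‖w‖⁻¹ • w, by simp [norm_smul, hw'.ne']⟩
        have h2 := F.inChart_pos he hy hw
        simp only [map_smul, F.inChart_smul he hy w (inv_nonneg.2 hw'.le), smul_eq_mul] at h1
        rw [mul_div_mul_left _ _ (inv_ne_zero hw'.ne'), div_le_iff₀ h2,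
          fderiv_comp_symm he hu hy] at h1
        exact h1
  · refine Real.sSup_le ?_ (F.dual_nonneg _ _)
    rintro _ ⟨w, -, rfl⟩
    exact hle w

theorem continuous_dual_differential (hu : ContMDiff (𝓡 n) 𝓘(ℝ, ℝ) ∞ u) :
    Continuous fun x => F.dual x (differential u x) := by
  refine continuous_iff_continuousAt.2 fun x₀ => ?_
  set e := chartAt 𝔼 x₀
  have he : e ∈ atlas 𝔼 M := chart_mem_atlas 𝔼 x₀
  have hx₀ : x₀ ∈ e.source := mem_chart_source 𝔼 x₀
  have hne : ∀ w : Metric.sphere (0 : 𝔼) 1, (w : 𝔼) ≠ 0 := fun w => by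
    have := w.2
    rintro h
    simp [h] at this
  have hD : ContinuousOn (fderiv ℝ (u ∘ e.symm)) e.target :=
    (contDiffOn_comp_symm he hu).continuousOn_fderiv_of_isOpen e.open_target (by simp)
  have hD' : Continuous fun y : e.target => fderiv ℝ (u ∘ e.symm) y :=
    continuousOn_iff_continuous_domRestrict.1 hD
  have hG : Continuous fun q : e.target × Metric.sphere (0 : 𝔼) 1 => F.inChart e q.1 q.2 :=
    (F.continuousOn_inChart he).comp_continuous (f := fun q : e.target × Metric.sphere (0 : 𝔼) 1 =>
      ((q.1 : 𝔼), (q.2 : 𝔼))) (by fun_prop) fun q => ⟨q.1.2, hne q.2⟩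
  have hcont : Continuous fun y : e.target => sSup ((fun w : Metric.sphere (0 : 𝔼) 1 =>
        fderiv ℝ (u ∘ e.symm) y w / F.inChart e y w) '' Set.univ) := by
    refine IsCompact.continuous_sSup isCompact_univ
      (f := fun (y : e.target) (w : Metric.sphere (0 : 𝔼) 1) =>
        fderiv ℝ (u ∘ e.symm) y w / F.inChart e y w) ?_
    refine Continuous.div ?_ hG fun q => (F.inChart_pos he q.1.2 (hne q.2)).ne'
    exact (hD'.comp continuous_fst).clm_apply (continuous_subtype_val.comp continuous_snd)
  have h1 : ContinuousOn (fun y => F.dual (e.symm y) (differential u (e.symm y))) e.target := by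
    rw [continuousOn_iff_continuous_domRestrict]
    refine hcont.congr fun y => ?_
    exact (F.dual_differential_eq he hu y.2).symm
  have h2 : ContinuousAt ((fun y => F.dual (e.symm y) (differential u (e.symm y))) ∘ e) x₀ :=
    (h1.continuousAt (e.open_target.mem_nhds (e.map_source hx₀))).comp (e.continuousAt hx₀)
  refine h2.congr ?_
  filter_upwards [e.open_source.mem_nhds hx₀] with x hx
  simp only [Function.comp]
  rw [e.left_inv hx]

theorem fderiv_comp_symm_norm_le (he : e ∈ atlas 𝔼 M)
    (hu : ContMDiff (𝓡 n) 𝓘(ℝ, ℝ) ∞ u) {y : 𝔼}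
    (hy : y ∈ e.target) {b : ℝ} (hb : 0 ≤ b) (h : ∀ w, F.inChart e y w ≤ b * ‖w‖) :
    ‖fderiv ℝ (u ∘ e.symm) y‖ ≤ b * F.dual (e.symm y) (differential u (e.symm y)) := by
  have hd := F.dual_nonneg (e.symm y) (differential u (e.symm y))
  have key : ∀ w, fderiv ℝ (u ∘ e.symm) y w ≤
      b * F.dual (e.symm y) (differential u (e.symm y)) * ‖w‖ := fun w => by
    rw [fderiv_comp_symm he hu hy, mul_right_comm, mul_comm]
    exact (F.apply_le_dual_mul _ _ _).trans (mul_le_mul_of_nonneg_left (h w) hd)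
  refine ContinuousLinearMap.opNorm_le_bound _ (by positivity) fun w => abs_le.2 ⟨?_, key w⟩
  have := key (-w)
  rw [map_neg, norm_neg] at this
  linarith

end Chart

end FinslerMetric

theorem ContinuousOn.measurableSet_preimage_inter {X Y : Type*} [TopologicalSpace X]
    [MeasurableSpace X] [OpensMeasurableSpace X] [TopologicalSpace Y] [MeasurableSpace Y]
    [BorelSpace Y] {f : X → Y} {s : Set X} (hf : ContinuousOn f s) (hs : MeasurableSet s)
    {A : Set Y} (hA : MeasurableSet A) : MeasurableSet (f ⁻¹' A ∩ s) := by
  have h1 : Measurable (s.domRestrict f) := (continuousOn_iff_continuous_domRestrict.1 hf).measurable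
  have h2 : f ⁻¹' A ∩ s = Subtype.val '' (s.domRestrict f ⁻¹' A) := by
    ext x
    simp [and_comm]
  rw [h2]
  exact hs.subtype_image (h1 hA)

namespace FinslerMetric

section Density

variable {n : ℕ} {M : Type*} [TopologicalSpace M]
  [ChartedSpace (EuclideanSpace ℝ (Fin n)) M] [IsManifold (𝓡 n) ∞ M]
  (F F₀ : FinslerMetric n M) {e e' : OpenPartialHomeomorph M (EuclideanSpace ℝ (Fin n))}

local notation "𝔼" => EuclideanSpace ℝ (Fin n)

theorem bhDensity_eq (y : 𝔼) : F.bhDensity e y =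
    volume (Metric.ball (0 : 𝔼) 1) / volume {w : 𝔼 | F.inChart e y w < 1} := rfl

theorem differentiableAt_transition (he : e ∈ atlas 𝔼 M) (he' : e' ∈ atlas 𝔼 M) {y : 𝔼}
    (hy : y ∈ e'.target) (hye : e'.symm y ∈ e.source) : DifferentiableAt ℝ (e ∘ e'.symm) y := by
  have : IsManifold (𝓡 n) 1 M := IsManifold.of_le (n := ∞) (by simp)
  exact mdifferentiableAt_iff_differentiableAt.1
    ((mdifferentiableAt_atlas he hye).comp y (mdifferentiableAt_atlas_symm he' hy))

theorem inChart_transition (he : e ∈ atlas 𝔼 M) (he' : e' ∈ atlas 𝔼 M) {y : 𝔼}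
    (hy : y ∈ e'.target) (hye : e'.symm y ∈ e.source) (w : 𝔼) :
    F.inChart e' y w =
      F.inChart e ((e ∘ e'.symm) y) (fderiv ℝ (e ∘ e'.symm) y w) := by
  have : IsManifold (𝓡 n) 1 M := IsManifold.of_le (n := ∞) (by simp)
  have hev : e'.symm =ᶠ[𝓝 y] e.symm ∘ (e ∘ e'.symm) := by
    filter_upwards [e'.open_target.mem_nhds hy,
      (e'.continuousAt_symm hy).preimage_mem_nhds (e.open_source.mem_nhds hye)] with z _ hz
    exact (e.left_inv hz).symm
  have h1 : tangentMap (𝓡 n) (𝓡 n) e'.symm ⟨y, w⟩ =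
      tangentMap (𝓡 n) (𝓡 n) (e.symm ∘ (e ∘ e'.symm)) ⟨y, w⟩ := by
    refine Bundle.TotalSpace.ext hev.eq_of_nhds (heq_of_eq ?_)
    exact DFunLike.congr_fun (hev.mfderiv_eq (I := 𝓡 n) (I' := 𝓡 n)) w
  have h2 : MDifferentiableAt (𝓡 n) (𝓡 n) (e ∘ e'.symm) y :=
    (mdifferentiableAt_atlas he hye).comp y (mdifferentiableAt_atlas_symm he' hy)
  have h3 := h1.trans (tangentMap_comp_at (I' := 𝓡 n) (⟨y, w⟩ : TangentBundle (𝓡 n) 𝔼)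
    (mdifferentiableAt_atlas_symm he (e.map_source hye)) h2)
  rw [← mfderiv_eq_fderiv]
  exact congrArg F h3

theorem bhDensity_transition (he : e ∈ atlas 𝔼 M) (he' : e' ∈ atlas 𝔼 M) {y : 𝔼}
    (hy : y ∈ e'.target) (hye : e'.symm y ∈ e.source) :
    F.bhDensity e' y = ENNReal.ofReal |(fderiv ℝ (e ∘ e'.symm) y).det| *
      F.bhDensity e ((e ∘ e'.symm) y) := by
  set L := fderiv ℝ (e ∘ e'.symm) y with hL
  have hdet : L.det ≠ 0 := by
    intro h0
    obtain ⟨w, hw, hw0⟩ := (Submodule.ne_bot_iff _).1 (LinearMap.bot_lt_ker_of_det_eq_zero h0).ne'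
    have h1 := F.inChart_pos he' hy hw0
    have h2 : L w = 0 := hw
    rw [F.inChart_transition he he' hy hye, ← hL, h2] at h1
    have h3 := F.inChart_smul he (e.map_source hye) 0 le_rfl
    simp only [smul_zero, zero_mul] at h3
    exact h1.ne' h3
  have h1 : {w : 𝔼 | F.inChart e' y w < 1} =
      L.toLinearMap ⁻¹' {w : 𝔼 | F.inChart e ((e ∘ e'.symm) y) w < 1} := by
    ext w
    simp only [Set.mem_ofPred_eq, Set.mem_preimage]
    rw [F.inChart_transition he he' hy hye]
    rfl
  have hpos : ENNReal.ofReal |L.det| ≠ 0 := by simpa using hdet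
  have h2 : ENNReal.ofReal |(LinearMap.det L.toLinearMap)⁻¹| = (ENNReal.ofReal |L.det|)⁻¹ := by
    rw [abs_inv]
    exact ENNReal.ofReal_inv_of_pos (abs_pos.2 hdet)
  rw [F.bhDensity_eq, F.bhDensity_eq, h1, Measure.addHaar_preimage_linearMap _ hdet, h2,
    ENNReal.div_eq_inv_mul, ENNReal.mul_inv (by simp) (by simp [hpos]), inv_inv, mul_assoc,
    ← ENNReal.div_eq_inv_mul]

theorem exists_bhDensity_bounds (he : e ∈ atlas 𝔼 M) {K : Set 𝔼} (hK : IsCompact K)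
    (hKe : K ⊆ e.target) : ∃ c₁ c₂ : ℝ≥0∞, c₁ ≠ 0 ∧ c₁ ≠ ⊤ ∧ c₂ ≠ ⊤ ∧ ∀ y ∈ K,
      c₁ ≤ F.bhDensity e y ∧ F.bhDensity e y ≤ c₂ := by
  obtain ⟨a, b, ha, hb, hab⟩ := F.exists_inChart_bounds he hK hKe
  have hpos : ∀ r : ℝ, 0 < r → volume (Metric.ball (0 : 𝔼) r) ≠ 0 := fun r hr =>
    (Metric.measure_ball_pos volume _ hr).ne'
  have hfin : ∀ r : ℝ, volume (Metric.ball (0 : 𝔼) r) ≠ ⊤ := fun r => measure_ball_lt_top.ne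
  refine ⟨volume (Metric.ball (0 : 𝔼) 1) / volume (Metric.ball (0 : 𝔼) a⁻¹),
    volume (Metric.ball (0 : 𝔼) 1) / volume (Metric.ball (0 : 𝔼) b⁻¹),
    ENNReal.div_ne_zero.2 ⟨hpos 1 one_pos, hfin _⟩,
    ENNReal.div_ne_top (hfin _) (hpos _ (inv_pos.2 ha)),
    ENNReal.div_ne_top (hfin _) (hpos _ (inv_pos.2 hb)), fun y hy => ?_⟩
  rw [F.bhDensity_eq]
  constructor
  · refine ENNReal.div_le_div_left (measure_mono fun w hw => ?_) _
    rw [mem_ball_zero_iff, ← one_div, lt_div_iff₀ ha, mul_comm]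
    exact (hab y hy w).1.trans_lt hw
  · refine ENNReal.div_le_div_left (measure_mono fun w hw => ?_) _
    rw [mem_ball_zero_iff, ← one_div, lt_div_iff₀ hb, mul_comm] at hw
    exact (hab y hy w).2.trans_lt hw

open scoped Pointwise in
theorem bhDensity_le_mul {C : ℝ} (hC : 0 < C) (h : ∀ v, F v ≤ C * F₀ v) (y : 𝔼) :
    F.bhDensity e y ≤ ENNReal.ofReal (C ^ n) * F₀.bhDensity e y := by
  have h1 : C⁻¹ • {w : 𝔼 | F₀.inChart e y w < 1} ⊆ {w : 𝔼 | F.inChart e y w < 1} := by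
    rintro _ ⟨w, hw, rfl⟩
    have h2 : F.inChart e y (C⁻¹ • w) ≤ C * F₀.inChart e y (C⁻¹ • w) := h _
    have h3 : F₀.inChart e y (C⁻¹ • w) = C⁻¹ * F₀.inChart e y w :=
      (congrArg (fun v => F₀ ⟨e.symm y, v⟩)
        ((mfderiv (𝓡 n) (𝓡 n) e.symm y).map_smul C⁻¹ w)).trans
          (F₀.homogeneous _ _ _ (by positivity))
    rw [h3, mul_inv_cancel_left₀ hC.ne'] at h2
    exact h2.trans_lt hw
  have h2 := measure_mono (μ := (volume : Measure 𝔼)) h1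
  rw [Measure.addHaar_smul, finrank_euclideanSpace_fin, inv_pow, abs_inv,
    abs_of_pos (pow_pos hC n), ENNReal.ofReal_inv_of_pos (pow_pos hC n)] at h2
  rw [F.bhDensity_eq, F₀.bhDensity_eq]
  refine (ENNReal.div_le_div_left h2 _).trans (le_of_eq ?_)
  have hpos : ENNReal.ofReal (C ^ n) ≠ 0 := by simpa using pow_pos hC n
  rw [ENNReal.div_eq_inv_mul, ENNReal.mul_inv (by simp) (by simp [hpos]), inv_inv, mul_assoc,
    ← ENNReal.div_eq_inv_mul]

theorem bhChartMeasure_le_bhMeasure [MeasurableSpace M] (he : e ∈ atlas 𝔼 M) : F.bhChartMeasure e ≤ F.bhMeasure :=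
  le_iSup₂_of_le e he le_rfl

end Density

section ChartBall

variable {n : ℕ} {M : Type*} [TopologicalSpace M] [ChartedSpace (EuclideanSpace ℝ (Fin n)) M]

local notation "𝔼" => EuclideanSpace ℝ (Fin n)

theorem exists_chart_ball (x₀ : M) : ∃ r > 0, Metric.closedBall (chartAt 𝔼 x₀ x₀) r ⊆
      (chartAt 𝔼 x₀).target ∧
      IsOpen ((chartAt 𝔼 x₀).symm '' Metric.ball (chartAt 𝔼 x₀ x₀) r) ∧
      x₀ ∈ (chartAt 𝔼 x₀).symm '' Metric.ball (chartAt 𝔼 x₀ x₀) r := by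
  obtain ⟨r, hr, hball⟩ := Metric.nhds_basis_closedBall.mem_iff.1
      ((chartAt 𝔼 x₀).open_target.mem_nhds (mem_chart_target 𝔼 x₀))
  exact ⟨r, hr, hball, (chartAt 𝔼 x₀).isOpen_image_symm_of_subset_target Metric.isOpen_ball
    (Metric.ball_subset_closedBall.trans hball), _, Metric.mem_ball_self hr,
    (chartAt 𝔼 x₀).left_inv (mem_chart_source 𝔼 x₀)⟩

end ChartBall

section Measure

variable {n : ℕ} {M : Type*} [TopologicalSpace M]
  [ChartedSpace (EuclideanSpace ℝ (Fin n)) M] [IsManifold (𝓡 n) ∞ M]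
  [MeasurableSpace M] [BorelSpace M]
  (F F₀ : FinslerMetric n M) {e e' : OpenPartialHomeomorph M (EuclideanSpace ℝ (Fin n))}

local notation "𝔼" => EuclideanSpace ℝ (Fin n)

theorem aemeasurable_chart_symm (e : OpenPartialHomeomorph M (EuclideanSpace ℝ (Fin n))) :
    AEMeasurable e.symm ((volume.restrict e.target).withDensity (F.bhDensity e)) :=
  (e.continuousOn_symm.aemeasurable e.open_target.measurableSet).mono_ac
    (withDensity_absolutelyContinuous _ _)

theorem bhChartMeasure_apply (e : OpenPartialHomeomorph M (EuclideanSpace ℝ (Fin n)))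
    {A : Set M} (hA : MeasurableSet A) :
    F.bhChartMeasure e A = ∫⁻ y in e.symm ⁻¹' A ∩ e.target, F.bhDensity e y := by
  rw [bhChartMeasure, Measure.map_apply_of_aemeasurable (F.aemeasurable_chart_symm e) hA,
    withDensity_apply', Measure.restrict_restrict' e.open_target.measurableSet]

theorem bhChartMeasure_apply_le (he : e ∈ atlas 𝔼 M) (he' : e' ∈ atlas 𝔼 M)
    {A : Set M} (hA : MeasurableSet A) (hAe : A ⊆ e.source) :
    F.bhChartMeasure e' A ≤ F.bhChartMeasure e A := by
  rw [bhChartMeasure_apply F e hA, bhChartMeasure_apply F e' hA]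
  set S' := e'.symm ⁻¹' A ∩ e'.target with hS'
  have hmeas : MeasurableSet S' :=
    e'.continuousOn_symm.measurableSet_preimage_inter e'.open_target.measurableSet hA
  have himage : (e ∘ e'.symm) '' S' ⊆ e.symm ⁻¹' A ∩ e.target := by
    rintro _ ⟨y, hy, rfl⟩
    have : e'.symm y ∈ e.source := hAe hy.1
    refine ⟨?_, e.map_source this⟩
    simpa [e.left_inv this] using hy.1
  have hinj : Set.InjOn (e ∘ e'.symm) S' := by
    intro y hy z hz h
    exact e'.symm.injOn hy.2 hz.2 (e.injOn (hAe hy.1) (hAe hz.1) h)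
  calc ∫⁻ y in S', F.bhDensity e' y
      = ∫⁻ y in S', ENNReal.ofReal |(fderiv ℝ (e ∘ e'.symm) y).det| *
          F.bhDensity e ((e ∘ e'.symm) y) :=
        setLIntegral_congr_fun hmeas fun y hy =>
          F.bhDensity_transition he he' hy.2 (hAe hy.1)
    _ = ∫⁻ y in (e ∘ e'.symm) '' S', F.bhDensity e y :=
        (lintegral_image_eq_lintegral_abs_det_fderiv_mul volume hmeas (fun y hy =>
          (differentiableAt_transition he he' hy.2 (hAe hy.1)).hasFDerivAt.hasFDerivWithinAt)
          hinj _).symm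
    _ ≤ _ := lintegral_mono_set himage

theorem bhMeasure_apply_le (he : e ∈ atlas 𝔼 M) {A : Set M} (hA : MeasurableSet A)
    (hAe : A ⊆ e.source) : F.bhMeasure A ≤ F.bhChartMeasure e A := by
  have h1 : F.bhMeasure ≤ (F.bhChartMeasure e).restrict A + (⊤ : Measure M).restrict Aᶜ := by
    refine iSup₂_le fun e' he' => Measure.le_iff.2 fun s hs => ?_
    rw [Measure.add_apply, Measure.restrict_apply hs, Measure.restrict_apply hs,
      ← measure_inter_add_sdiff s hA]
    exact add_le_add (F.bhChartMeasure_apply_le he he' (hs.inter hA)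
      (Set.inter_subset_right.trans hAe)) (Measure.le_iff.1 le_top _ (hs.diff hA))
  refine (h1 A).trans ?_
  rw [Measure.add_apply, Measure.restrict_apply hA, Measure.restrict_apply hA]
  simp

theorem bhMeasure_le_smul {C : ℝ} (hC : 0 < C) (h : ∀ v, F v ≤ C * F₀ v) :
    F.bhMeasure ≤ ENNReal.ofReal (C ^ n) • F₀.bhMeasure := by
  refine iSup₂_le fun e he => Measure.le_iff.2 fun s hs => ?_
  calc F.bhChartMeasure e s
      ≤ ∫⁻ y in e.symm ⁻¹' s ∩ e.target, ENNReal.ofReal (C ^ n) * F₀.bhDensity e y := by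
        rw [F.bhChartMeasure_apply e hs]
        exact lintegral_mono fun y => F.bhDensity_le_mul F₀ hC h y
    _ = ENNReal.ofReal (C ^ n) * F₀.bhChartMeasure e s := by
        rw [F₀.bhChartMeasure_apply e hs, lintegral_const_mul' _ _ ENNReal.ofReal_ne_top]
    _ ≤ (ENNReal.ofReal (C ^ n) • F₀.bhMeasure) s := by
        rw [Measure.smul_apply, smul_eq_mul]
        exact mul_le_mul_right (F₀.bhChartMeasure_le_bhMeasure he s) _

/-- In a chart, the Busemann–Hausdorff measure is comparable to the Lebesgue measure on a ball
whose closure is contained in the target. -/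
theorem exists_bhMeasure_comparison (he : e ∈ atlas 𝔼 M) {y₀ : 𝔼} {r : ℝ}
    (hr : Metric.closedBall y₀ r ⊆ e.target) : ∃ c₁ c₂ : ℝ≥0∞, c₁ ≠ ⊤ ∧ c₂ ≠ ⊤ ∧
      (volume.restrict (Metric.ball y₀ r)).map e.symm ≤
        c₁ • F.bhMeasure.restrict (e.symm '' Metric.ball y₀ r) ∧
      F.bhMeasure.restrict (e.symm '' Metric.ball y₀ r) ≤
        c₂ • (volume.restrict (Metric.ball y₀ r)).map e.symm := by
  obtain ⟨c₁, c₂, h10, h1, h2, hc⟩ := F.exists_bhDensity_bounds he (isCompact_closedBall y₀ r) hr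
  set B := Metric.ball y₀ r
  have hB : B ⊆ e.target := Metric.ball_subset_closedBall.trans hr
  set U := e.symm '' B
  have hU : MeasurableSet U :=
    (e.isOpen_image_symm_of_subset_target Metric.isOpen_ball hB).measurableSet
  have hUe : U ⊆ e.source := by
    rintro _ ⟨y, hy, rfl⟩
    exact e.map_target (hB hy)
  have hae : AEMeasurable e.symm (volume.restrict B) :=
    (e.continuousOn_symm.mono hB).aemeasurable Metric.isOpen_ball.measurableSet
  have hset : ∀ s : Set M, e.symm ⁻¹' (s ∩ U) ∩ e.target = e.symm ⁻¹' s ∩ B := by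
    intro s
    ext y
    constructor
    · rintro ⟨⟨hs, z, hz, hzy⟩, hy⟩
      exact ⟨hs, e.symm.injOn (hB hz) hy hzy ▸ hz⟩
    · rintro ⟨hs, hy⟩
      exact ⟨⟨hs, y, hy, rfl⟩, hB hy⟩
  have hmeas : ∀ s : Set M, MeasurableSet s → MeasurableSet (e.symm ⁻¹' s ∩ B) := fun s hs =>
    (e.continuousOn_symm.mono hB).measurableSet_preimage_inter Metric.isOpen_ball.measurableSet hs
  have hmap : ∀ s : Set M, MeasurableSet s → (volume.restrict B).map e.symm s =
      volume (e.symm ⁻¹' s ∩ B) := fun s hs => by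
    rw [Measure.map_apply_of_aemeasurable hae hs,
      Measure.restrict_apply' Metric.isOpen_ball.measurableSet]
  refine ⟨c₁⁻¹, c₂, by simpa using h10, h2, Measure.le_iff.2 fun s hs => ?_,
    Measure.le_iff.2 fun s hs => ?_⟩
  · rw [hmap s hs, Measure.smul_apply, smul_eq_mul, Measure.restrict_apply hs,
      ← ENNReal.div_eq_inv_mul, ENNReal.le_div_iff_mul_le (.inl h10) (.inl h1), mul_comm]
    calc c₁ * volume (e.symm ⁻¹' s ∩ B) = ∫⁻ y in e.symm ⁻¹' s ∩ B, c₁ :=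
          (setLIntegral_const _ _).symm
      _ ≤ ∫⁻ y in e.symm ⁻¹' s ∩ B, F.bhDensity e y :=
          setLIntegral_mono' (hmeas s hs) fun y hy => (hc y (Metric.ball_subset_closedBall hy.2)).1
      _ = F.bhChartMeasure e (s ∩ U) := by rw [F.bhChartMeasure_apply e (hs.inter hU), hset]
      _ ≤ F.bhMeasure (s ∩ U) := F.bhChartMeasure_le_bhMeasure he _
  · rw [Measure.smul_apply, hmap s hs, smul_eq_mul, Measure.restrict_apply hs]
    calc F.bhMeasure (s ∩ U) ≤ F.bhChartMeasure e (s ∩ U) :=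
          F.bhMeasure_apply_le he (hs.inter hU) (Set.inter_subset_right.trans hUe)
      _ = ∫⁻ y in e.symm ⁻¹' s ∩ B, F.bhDensity e y := by
          rw [F.bhChartMeasure_apply e (hs.inter hU), hset]
      _ ≤ ∫⁻ y in e.symm ⁻¹' s ∩ B, c₂ :=
          setLIntegral_mono' (hmeas s hs) fun y hy => (hc y (Metric.ball_subset_closedBall hy.2)).2
      _ = c₂ * volume (e.symm ⁻¹' s ∩ B) := setLIntegral_const _ _

theorem isFiniteMeasure_bhMeasure [CompactSpace M] : IsFiniteMeasure F.bhMeasure := by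
  refine ⟨isCompact_univ.measure_lt_top_of_nhdsWithin fun x₀ _ => ?_⟩
  obtain ⟨r, hr, hball, hopen, hx₀⟩ := exists_chart_ball (n := n) x₀
  obtain ⟨c₁, c₂, -, hc₂, -, h⟩ := F.exists_bhMeasure_comparison (chart_mem_atlas 𝔼 x₀) hball
  refine ⟨_, mem_nhdsWithin_of_mem_nhds (hopen.mem_nhds hx₀), ?_⟩
  have h1 := h Set.univ
  rw [Measure.restrict_apply_univ, Measure.smul_apply, smul_eq_mul] at h1
  refine h1.trans_lt (ENNReal.mul_lt_top hc₂.lt_top ?_)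
  have hae : AEMeasurable (chartAt 𝔼 x₀).symm
      (volume.restrict (Metric.ball (chartAt 𝔼 x₀ x₀) r)) :=
    ((chartAt 𝔼 x₀).continuousOn_symm.mono
      (Metric.ball_subset_closedBall.trans hball)).aemeasurable Metric.isOpen_ball.measurableSet
  rw [Measure.map_apply_of_aemeasurable hae .univ, Set.preimage_univ, Measure.restrict_apply_univ]
  exact measure_ball_lt_top

theorem isOpenPosMeasure_bhMeasure : F.bhMeasure.IsOpenPosMeasure := by
  refine ⟨fun V hV ⟨x₀, hx⟩ h0 => ?_⟩
  obtain ⟨r, hr, hball, hopen, hx₀⟩ := exists_chart_ball (n := n) x₀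
  obtain ⟨c₁, c₂, -, -, h, -⟩ := F.exists_bhMeasure_comparison (chart_mem_atlas 𝔼 x₀) hball
  set e := chartAt 𝔼 x₀
  have hB : Metric.ball (e x₀) r ⊆ e.target := Metric.ball_subset_closedBall.trans hball
  have h1 := h V
  have hae : AEMeasurable e.symm (volume.restrict (Metric.ball (e x₀) r)) :=
    (e.continuousOn_symm.mono hB).aemeasurable Metric.isOpen_ball.measurableSet
  rw [Measure.map_apply_of_aemeasurable hae hV.measurableSet,
      Measure.restrict_apply' Metric.isOpen_ball.measurableSet, Measure.smul_apply, smul_eq_mul,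
      Measure.restrict_apply hV.measurableSet, measure_mono_null Set.inter_subset_left h0,
      mul_zero, nonpos_iff_eq_zero] at h1
  refine (IsOpen.measure_pos volume (U := e.symm ⁻¹' V ∩ Metric.ball (e x₀) r) ?_
    ⟨e x₀, ?_, Metric.mem_ball_self hr⟩).ne' h1
  · rw [Set.inter_comm]
    exact (e.continuousOn_symm.mono hB).isOpen_inter_preimage Metric.isOpen_ball hV
  · simpa [e] using hx

end Measure

end FinslerMetric

section Poincare

variable {E : Type*} [NormedAddCommGroup E] [NormedSpace ℝ E] [FiniteDimensional ℝ E]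
  [MeasurableSpace E] [BorelSpace E] (μ : Measure E) [μ.IsAddHaarMeasure]

theorem lintegral_comp_add_smul_le {h : E → ℝ≥0∞} (hh : Measurable h) (a : E) {t : ℝ}
    (ht : 1 / 2 ≤ t) : ∫⁻ x, h (a + t • x) ∂μ ≤ 2 ^ Module.finrank ℝ E * ∫⁻ x, h x ∂μ := by
  have ht0 : 0 < t := by linarith
  have h1 : Measurable fun x => h (a + x) := hh.comp (measurable_const_add a)
  have h2 : ∫⁻ x, h (a + t • x) ∂μ = ∫⁻ x, h (a + x) ∂(μ.map (t • ·)) :=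
    (lintegral_map h1 (measurable_const_smul t)).symm
  rw [h2, Measure.map_addHaar_smul μ ht0.ne', lintegral_smul_measure,
    lintegral_add_left_eq_self h a, smul_eq_mul]
  gcongr
  rw [abs_of_pos (by positivity), ← inv_pow, ENNReal.ofReal_pow (by positivity)]
  gcongr
  rw [← ENNReal.ofReal_ofNat 2]
  apply ENNReal.ofReal_le_ofReal
  rw [inv_le_comm₀ ht0 two_pos]
  linarith

theorem lintegral_lintegral_segment_le {h : E → ℝ≥0∞} (hh : Measurable h) {B : Set E}
    (hB : μ B ≠ ⊤) {t : ℝ} :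
    ∫⁻ y in B, ∫⁻ x in B, h ((1 - t) • y + t • x) ∂μ ∂μ ≤
      2 ^ Module.finrank ℝ E * (∫⁻ x, h x ∂μ) * μ B := by
  rcases le_total (1 / 2) t with ht | ht
  · calc ∫⁻ y in B, ∫⁻ x in B, h ((1 - t) • y + t • x) ∂μ ∂μ
        ≤ ∫⁻ y in B, 2 ^ Module.finrank ℝ E * (∫⁻ x, h x ∂μ) ∂μ :=
          lintegral_mono fun y => (lintegral_mono' Measure.restrict_le_self le_rfl).trans
            (lintegral_comp_add_smul_le μ hh _ ht)
      _ = _ := setLIntegral_const _ _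
  · have : IsFiniteMeasure (μ.restrict B) := ⟨by simpa using hB.lt_top⟩
    rw [lintegral_lintegral_swap (by
      refine (hh.comp ?_).aemeasurable
      fun_prop)]
    calc ∫⁻ x in B, ∫⁻ y in B, h ((1 - t) • y + t • x) ∂μ ∂μ
        ≤ ∫⁻ x in B, 2 ^ Module.finrank ℝ E * (∫⁻ x, h x ∂μ) ∂μ := by
          refine lintegral_mono fun x => ?_
          simp_rw [add_comm _ (t • x)]
          exact (lintegral_mono' Measure.restrict_le_self le_rfl).trans
            (lintegral_comp_add_smul_le μ hh _ (by linarith))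
      _ = _ := setLIntegral_const _ _

theorem lintegral_rpow_le_of_isProbabilityMeasure {Ω : Type*} [MeasurableSpace Ω] (ν : Measure Ω)
    [IsProbabilityMeasure ν] {p : ℝ} (hp : 1 ≤ p) {f : Ω → ℝ≥0∞} (hf : Measurable f) :
    (∫⁻ t, f t ∂ν) ^ p ≤ ∫⁻ t, f t ^ p ∂ν := by
  have h := eLpNorm'_le_eLpNorm'_of_exponent_le one_pos hp ν hf.aestronglyMeasurable
  simp only [eLpNorm', ENNReal.rpow_one, enorm_eq_self, div_one] at h
  rw [one_div, ENNReal.le_rpow_inv_iff (by linarith)] at h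
  exact h

theorem enorm_sub_rpow_le_lintegral_segment {p : ℝ} (hp : 1 ≤ p) {U : Set E} (hU : IsOpen U)
    (hconv : Convex ℝ U) {u : E → ℝ} (hu : ContDiffOn ℝ 1 u U) {x y : E} (hx : x ∈ U)
    (hy : y ∈ U) :
    ‖u x - u y‖ₑ ^ p ≤ ‖x - y‖ₑ ^ p *
      ∫⁻ t in Set.Ioc (0 : ℝ) 1, ‖fderiv ℝ u ((1 - t) • y + t • x)‖ₑ ^ p := by
  have hmem : ∀ t ∈ Set.Icc (0 : ℝ) 1, (1 - t) • y + t • x ∈ U := fun t ht =>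
    hconv hy hx (by linarith [ht.2]) ht.1 (by ring)
  have hline : ∀ t : ℝ, HasDerivAt (fun t : ℝ => (1 - t) • y + t • x) (x - y) t := fun t => by
    have h1 : HasDerivAt (fun t : ℝ => (1 - t)) (-1) t := by
      simpa using (hasDerivAt_id t).const_sub 1
    have h2 : HasDerivAt (fun t : ℝ => (1 - t) • y + t • x) ((-1 : ℝ) • y + (1 : ℝ) • x) t :=
      (h1.smul_const y).add ((hasDerivAt_id t).smul_const x)
    exact h2.congr_deriv (by module)
  have hderiv : ∀ t ∈ Set.uIcc (0 : ℝ) 1, HasDerivAt (fun t : ℝ => u ((1 - t) • y + t • x))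
      (fderiv ℝ u ((1 - t) • y + t • x) (x - y)) t := fun t ht => by
    rw [Set.uIcc_of_le zero_le_one] at ht
    exact ((hu.differentiableOn (by simp)).differentiableAt
      (hU.mem_nhds (hmem t ht))).hasFDerivAt.comp_hasDerivAt t (hline t)
  have hcont : ContinuousOn (fun t : ℝ => fderiv ℝ u ((1 - t) • y + t • x) (x - y))
      (Set.uIcc 0 1) := by
    rw [Set.uIcc_of_le zero_le_one]
    exact ((hu.continuousOn_fderiv_of_isOpen hU le_rfl).comp (by fun_prop) hmem).clm_apply
      continuousOn_const
  have hFTC := intervalIntegral.integral_eq_sub_of_hasDerivAt hderiv hcont.intervalIntegrable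
  simp only [sub_self, zero_smul, one_smul, zero_add, sub_zero, add_zero] at hFTC
  rw [← hFTC, intervalIntegral.integral_of_le zero_le_one]
  have hprob : IsProbabilityMeasure (volume.restrict (Set.Ioc (0 : ℝ) 1)) := ⟨by simp⟩
  have hmeas : Measurable fun t : ℝ => ‖fderiv ℝ u ((1 - t) • y + t • x)‖ₑ :=
    (measurable_fderiv ℝ u).enorm.comp (by fun_prop)
  calc ‖∫ t in Set.Ioc (0 : ℝ) 1, fderiv ℝ u ((1 - t) • y + t • x) (x - y)‖ₑ ^ p
      ≤ (∫⁻ t in Set.Ioc (0 : ℝ) 1, ‖fderiv ℝ u ((1 - t) • y + t • x)‖ₑ * ‖x - y‖ₑ) ^ p := by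
        gcongr
        exact (enorm_integral_le_lintegral_enorm _).trans
          (lintegral_mono fun t => ContinuousLinearMap.le_opENorm _ _)
    _ = ‖x - y‖ₑ ^ p * (∫⁻ t in Set.Ioc (0 : ℝ) 1, ‖fderiv ℝ u ((1 - t) • y + t • x)‖ₑ) ^ p := by
        rw [lintegral_mul_const _ hmeas, ENNReal.mul_rpow_of_nonneg _ _ (by linarith), mul_comm]
    _ ≤ _ := by
        gcongr
        exact lintegral_rpow_le_of_isProbabilityMeasure _ hp hmeas

/-- The Poincaré inequality on a ball. -/
theorem exists_poincare_ball {p : ℝ} (hp : 1 ≤ p) (y₀ : E) {r : ℝ} (hr : 0 < r) :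
    ∃ A : ℝ≥0∞, A ≠ ⊤ ∧ ∀ u : E → ℝ, ContDiffOn ℝ 1 u (Metric.ball y₀ r) → ∃ c : ℝ,
      ∫⁻ x in Metric.ball y₀ r, ‖u x - c‖ₑ ^ p ∂μ ≤
        A * ∫⁻ x in Metric.ball y₀ r, ‖fderiv ℝ u x‖ₑ ^ p ∂μ := by
  set B := Metric.ball y₀ r with hBdef
  have hp0 : 0 ≤ p := by linarith
  have hBm : MeasurableSet B := measurableSet_ball
  have hBfin : μ B ≠ ⊤ := measure_ball_lt_top.ne
  have hBpos : μ B ≠ 0 := (Metric.measure_ball_pos μ y₀ hr).ne'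
  refine ⟨ENNReal.ofReal (2 * r) ^ p * 2 ^ Module.finrank ℝ E, by finiteness, fun u hu => ?_⟩
  set g : E → ℝ≥0∞ := B.indicator fun x => ‖fderiv ℝ u x‖ₑ ^ p
  have hg : Measurable g := ((measurable_fderiv ℝ u).enorm.pow_const p).indicator hBm
  have hgint : ∫⁻ x, g x ∂μ = ∫⁻ x in B, ‖fderiv ℝ u x‖ₑ ^ p ∂μ := lintegral_indicator hBm _
  have hum : AEMeasurable u (μ.restrict B) := hu.continuousOn.aemeasurable hBm
  have hpt : ∀ y ∈ B, ∀ x ∈ B, ‖u x - u y‖ₑ ^ p ≤ ENNReal.ofReal (2 * r) ^ p *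
      ∫⁻ t in Set.Ioc (0 : ℝ) 1, g ((1 - t) • y + t • x) := fun y hy x hx => by
    refine (enorm_sub_rpow_le_lintegral_segment hp Metric.isOpen_ball (convex_ball y₀ r) hu
      hx hy).trans ?_
    gcongr ?_ ^ p * ?_
    · rw [← ofReal_norm, ← dist_eq_norm]
      apply ENNReal.ofReal_le_ofReal
      have h1 := Metric.mem_ball.1 hx
      have h2 := Metric.mem_ball'.1 hy
      linarith [dist_triangle x y₀ y]
    · refine setLIntegral_mono' measurableSet_Ioc fun t ht => ?_
      have hmem : (1 - t) • y + t • x ∈ B :=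
        convex_ball y₀ r hy hx (by linarith [ht.2]) ht.1.le (by ring)
      exact (Set.indicator_of_mem hmem fun x => ‖fderiv ℝ u x‖ₑ ^ p).ge
  have hfin : IsFiniteMeasure (μ.restrict B) := ⟨by simpa using hBfin.lt_top⟩
  have hdouble : ∫⁻ y in B, ∫⁻ x in B, ‖u x - u y‖ₑ ^ p ∂μ ∂μ ≤
      ENNReal.ofReal (2 * r) ^ p * (2 ^ Module.finrank ℝ E * (∫⁻ x, g x ∂μ) * μ B) := by
    calc ∫⁻ y in B, ∫⁻ x in B, ‖u x - u y‖ₑ ^ p ∂μ ∂μ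
        ≤ ∫⁻ y in B, ∫⁻ x in B, ENNReal.ofReal (2 * r) ^ p *
            ∫⁻ t in Set.Ioc (0 : ℝ) 1, g ((1 - t) • y + t • x) ∂volume ∂μ ∂μ :=
          setLIntegral_mono' hBm fun y hy => setLIntegral_mono' hBm fun x hx => hpt y hy x hx
      _ = ENNReal.ofReal (2 * r) ^ p * ∫⁻ y in B, ∫⁻ x in B,
            ∫⁻ t in Set.Ioc (0 : ℝ) 1, g ((1 - t) • y + t • x) ∂volume ∂μ ∂μ := by
          have hD : ENNReal.ofReal (2 * r) ^ p ≠ ⊤ := by finiteness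
          simp_rw [lintegral_const_mul' _ _ hD]
      _ = ENNReal.ofReal (2 * r) ^ p * ∫⁻ t in Set.Ioc (0 : ℝ) 1, ∫⁻ y in B, ∫⁻ x in B,
            g ((1 - t) • y + t • x) ∂μ ∂μ ∂volume := by
          congr 1
          have h1 : ∀ y, ∫⁻ x in B, ∫⁻ t in Set.Ioc (0 : ℝ) 1, g ((1 - t) • y + t • x) ∂volume ∂μ =
              ∫⁻ t in Set.Ioc (0 : ℝ) 1, ∫⁻ x in B, g ((1 - t) • y + t • x) ∂μ ∂volume := fun y =>
            lintegral_lintegral_swap (f := fun x (t : ℝ) => g ((1 - t) • y + t • x))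
              (hg.comp (f := fun q : E × ℝ => (1 - q.2) • y + q.2 • q.1)
                (by fun_prop)).aemeasurable
          simp_rw [h1]
          refine lintegral_lintegral_swap (Measurable.aemeasurable ?_)
          refine Measurable.lintegral_prod_right' (ν := μ.restrict B)
            (f := fun q : (E × ℝ) × E => g ((1 - q.1.2) • q.1.1 + q.1.2 • q.2)) ?_
          exact hg.comp (by fun_prop)
      _ ≤ ENNReal.ofReal (2 * r) ^ p * ∫⁻ t in Set.Ioc (0 : ℝ) 1,
            (2 ^ Module.finrank ℝ E * (∫⁻ x, g x ∂μ) * μ B) := by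
          gcongr
          exact lintegral_lintegral_segment_le μ hg hBfin
      _ = _ := by simp
  obtain ⟨y, hy, hle⟩ := exists_le_setLAverage (μ := μ) (s := B)
    (f := fun y => ∫⁻ x in B, ‖u x - u y‖ₑ ^ p ∂μ) hBpos hBfin (by
      refine AEMeasurable.lintegral_prod_right' (f := fun q : E × E => ‖u q.2 - u q.1‖ₑ ^ p) ?_
      exact ((hum.comp_snd.sub hum.comp_fst).enorm).pow_const p)
  refine ⟨u y, hle.trans ?_⟩
  rw [setLAverage_eq, ENNReal.div_le_iff hBpos hBfin]
  refine hdouble.trans (le_of_eq ?_)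
  rw [hgint]
  ring

end Poincare

theorem enorm_sub_rpow_le {p : ℝ} (hp : 1 ≤ p) (a b c : ℝ) :
    ‖a - c‖ₑ ^ p ≤ 2 ^ (p - 1) * (‖a - b‖ₑ ^ p + ‖b - c‖ₑ ^ p) := by
  refine le_trans ?_ (ENNReal.rpow_add_le_mul_rpow_add_rpow _ _ hp)
  gcongr
  rw [← sub_add_sub_cancel a b c]
  exact enorm_add_le _ _

namespace FinslerMetric

variable {n : ℕ} {M : Type*} [TopologicalSpace M]
  [ChartedSpace (EuclideanSpace ℝ (Fin n)) M] [IsManifold (𝓡 n) ∞ M]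
  [MeasurableSpace M] (F : FinslerMetric n M)

local notation "𝔼" => EuclideanSpace ℝ (Fin n)

/-- A Poincaré inequality for smooth functions on `U`, with the energy of all of `M` on the right. -/
def PoincareOn (μ : Measure M) (p : ℝ) (U : Set M) : Prop :=
  ∃ A : ℝ≥0∞, A ≠ ⊤ ∧ ∀ u : M → ℝ, ContMDiff (𝓡 n) 𝓘(ℝ, ℝ) ∞ u → ∃ c : ℝ,
    ∫⁻ x in U, ‖u x - c‖ₑ ^ p ∂μ ≤ A * ∫⁻ x, ‖F.dual x (differential u x)‖ₑ ^ p ∂μ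

variable {F} {μ : Measure M} {p : ℝ} {U V : Set M}

theorem PoincareOn.mono (hV : F.PoincareOn μ p V) (h : U ⊆ V) : F.PoincareOn μ p U := by
  obtain ⟨A, hA, H⟩ := hV
  refine ⟨A, hA, fun u hu => ?_⟩
  obtain ⟨c, hc⟩ := H u hu
  exact ⟨c, (lintegral_mono_set h).trans hc⟩

theorem PoincareOn.union [BorelSpace M] [IsFiniteMeasure μ] (hp : 1 ≤ p)
    (hU : F.PoincareOn μ p U) (hV : F.PoincareOn μ p V) (hUV : μ (U ∩ V) ≠ 0) :
    F.PoincareOn μ p (U ∪ V) := by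
  obtain ⟨A, hA, HU⟩ := hU
  obtain ⟨B, hB, HV⟩ := hV
  have hp1 : 0 ≤ p - 1 := by linarith
  have hk : (2 : ℝ≥0∞) ^ (p - 1) ≠ ⊤ := by finiteness
  refine ⟨A + 2 ^ (p - 1) * (B + 2 ^ (p - 1) * (A + B) / μ (U ∩ V) * μ V), ?_, fun u hu => ?_⟩
  · have : 2 ^ (p - 1) * (A + B) / μ (U ∩ V) ≠ ⊤ := ENNReal.div_ne_top (by finiteness) hUV
    finiteness
  have hum : Measurable u := hu.continuous.measurable
  obtain ⟨a, ha⟩ := HU u hu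
  obtain ⟨b, hb⟩ := HV u hu
  set I := ∫⁻ x, ‖F.dual x (differential u x)‖ₑ ^ p ∂μ
  have hm : ∀ c : ℝ, Measurable fun x => ‖u x - c‖ₑ ^ p := fun c =>
    (hum.sub_const c).enorm.pow_const p
  have hab : ‖b - a‖ₑ ^ p ≤ 2 ^ (p - 1) * (A + B) / μ (U ∩ V) * I := by
    rw [← ENNReal.mul_div_right_comm,
      ENNReal.le_div_iff_mul_le (.inl hUV) (.inl (measure_ne_top _ _))]
    calc ‖b - a‖ₑ ^ p * μ (U ∩ V) = ∫⁻ _ in U ∩ V, ‖b - a‖ₑ ^ p ∂μ := (setLIntegral_const _ _).symm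
      _ ≤ ∫⁻ x in U ∩ V, 2 ^ (p - 1) * (‖u x - a‖ₑ ^ p + ‖u x - b‖ₑ ^ p) ∂μ := by
          refine lintegral_mono fun x => ?_
          rw [add_comm, enorm_sub_rev (u x) b]
          exact enorm_sub_rpow_le hp _ _ _
      _ = 2 ^ (p - 1) * (∫⁻ x in U ∩ V, ‖u x - a‖ₑ ^ p ∂μ +
            ∫⁻ x in U ∩ V, ‖u x - b‖ₑ ^ p ∂μ) := by
          rw [lintegral_const_mul' _ _ hk, lintegral_add_left (hm a)]
      _ ≤ 2 ^ (p - 1) * (A * I + B * I) := by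
          gcongr
          · exact (lintegral_mono_set Set.inter_subset_left).trans ha
          · exact (lintegral_mono_set Set.inter_subset_right).trans hb
      _ = 2 ^ (p - 1) * (A + B) * I := by ring
  refine ⟨a, ?_⟩
  calc ∫⁻ x in U ∪ V, ‖u x - a‖ₑ ^ p ∂μ
      ≤ ∫⁻ x in U, ‖u x - a‖ₑ ^ p ∂μ + ∫⁻ x in V, ‖u x - a‖ₑ ^ p ∂μ := lintegral_union_le _ _ _
    _ ≤ A * I + ∫⁻ x in V, 2 ^ (p - 1) * (‖u x - b‖ₑ ^ p + ‖b - a‖ₑ ^ p) ∂μ := by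
        gcongr
        exact enorm_sub_rpow_le hp _ _ _
    _ = A * I + 2 ^ (p - 1) * (∫⁻ x in V, ‖u x - b‖ₑ ^ p ∂μ + ‖b - a‖ₑ ^ p * μ V) := by
        rw [lintegral_const_mul' _ _ hk, lintegral_add_left (hm b), setLIntegral_const]
    _ ≤ A * I + 2 ^ (p - 1) * (B * I + 2 ^ (p - 1) * (A + B) / μ (U ∩ V) * I * μ V) := by gcongr
    _ = _ := by ring

variable (F)

theorem exists_poincareOn_nhds [BorelSpace M] (hp : 1 ≤ p) (x₀ : M) :
    ∃ U, IsOpen U ∧ x₀ ∈ U ∧ F.PoincareOn F.bhMeasure p U := by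
  obtain ⟨r, hr, hball, hopen, hx₀⟩ := exists_chart_ball (n := n) x₀
  have he : chartAt 𝔼 x₀ ∈ atlas 𝔼 M := chart_mem_atlas 𝔼 x₀
  refine ⟨_, hopen, hx₀, ?_⟩
  set e := chartAt 𝔼 x₀
  set B := Metric.ball (e x₀) r
  obtain ⟨c₁, c₂, hc₁, hc₂, h₁, h₂⟩ := F.exists_bhMeasure_comparison he hball
  obtain ⟨a, b, -, hb, hab⟩ := F.exists_inChart_bounds he (isCompact_closedBall (e x₀) r) hball
  obtain ⟨A, hA, HA⟩ := exists_poincare_ball (volume : Measure 𝔼) hp (e x₀) hr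
  have hB : B ⊆ e.target := Metric.ball_subset_closedBall.trans hball
  have hae : AEMeasurable e.symm (volume.restrict B) :=
    (e.continuousOn_symm.mono hB).aemeasurable Metric.isOpen_ball.measurableSet
  have hp0 : 0 ≤ p := by linarith
  refine ⟨c₂ * (A * (ENNReal.ofReal b ^ p * c₁)), by finiteness, fun u hu => ?_⟩
  have hum : Measurable u := hu.continuous.measurable
  obtain ⟨c, hc⟩ := HA (u ∘ e.symm) (((contDiffOn_comp_symm he hu).mono hB).of_le (by simp))
  have hdm : Measurable fun x => ‖F.dual x (differential u x)‖ₑ ^ p :=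
    (F.continuous_dual_differential hu).measurable.enorm.pow_const p
  refine ⟨c, ?_⟩
  calc ∫⁻ x in e.symm '' B, ‖u x - c‖ₑ ^ p ∂F.bhMeasure
      ≤ ∫⁻ x, ‖u x - c‖ₑ ^ p ∂(c₂ • (volume.restrict B).map e.symm) := lintegral_mono' h₂ le_rfl
    _ = c₂ * ∫⁻ y in B, ‖(u ∘ e.symm) y - c‖ₑ ^ p := by
        rw [lintegral_smul_measure, smul_eq_mul, lintegral_map'
          ((hum.sub_const c).enorm.pow_const p).aemeasurable hae]
        rfl
    _ ≤ c₂ * (A * ∫⁻ y in B, ‖fderiv ℝ (u ∘ e.symm) y‖ₑ ^ p) := by gcongr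
    _ ≤ c₂ * (A * ∫⁻ y in B, ENNReal.ofReal b ^ p *
          ‖F.dual (e.symm y) (differential u (e.symm y))‖ₑ ^ p) := by
        gcongr c₂ * (A * ?_)
        refine setLIntegral_mono' Metric.isOpen_ball.measurableSet fun y hy => ?_
        rw [← ENNReal.mul_rpow_of_nonneg _ _ hp0]
        gcongr
        have h := F.fderiv_comp_symm_norm_le he hu (hB hy) hb.le
          fun w => (hab y (Metric.ball_subset_closedBall hy) w).2
        rw [← ofReal_norm, Real.enorm_of_nonneg (F.dual_nonneg _ _), ← ENNReal.ofReal_mul hb.le]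
        exact ENNReal.ofReal_le_ofReal h
    _ = c₂ * (A * (ENNReal.ofReal b ^ p *
          ∫⁻ x, ‖F.dual x (differential u x)‖ₑ ^ p ∂((volume.restrict B).map e.symm))) := by
        rw [lintegral_const_mul' _ _ (by finiteness), lintegral_map' hdm.aemeasurable hae]
    _ ≤ c₂ * (A * (ENNReal.ofReal b ^ p *
          ∫⁻ x, ‖F.dual x (differential u x)‖ₑ ^ p ∂(c₁ • F.bhMeasure))) := by
        gcongr c₂ * (A * (_ * ?_))
        refine lintegral_mono' (h₁.trans ?_) le_rfl
        gcongr
        exact Measure.restrict_le_self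
    _ = _ := by
        rw [lintegral_smul_measure, smul_eq_mul]
        ring

theorem poincareOn_univ [BorelSpace M] [CompactSpace M] [ConnectedSpace M] (hp : 1 ≤ p) :
    F.PoincareOn F.bhMeasure p Set.univ := by
  have hfin := F.isFiniteMeasure_bhMeasure
  have hopen := F.isOpenPosMeasure_bhMeasure
  obtain ⟨x₀⟩ := (inferInstance : Nonempty M)
  have hUV : ∀ {U V : Set M} {x : M}, IsOpen U → IsOpen V → x ∈ U → x ∈ V →
      F.bhMeasure (U ∩ V) ≠ 0 := fun hU hV hxU hxV =>
    ((hU.inter hV).measure_pos _ ⟨_, hxU, hxV⟩).ne'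
  set S : Set M := {x | ∃ U, IsOpen U ∧ x₀ ∈ U ∧ x ∈ U ∧ F.PoincareOn F.bhMeasure p U}
  have hS : IsClopen S := by
    constructor
    · refine closure_subset_iff_isClosed.1 fun y hy => ?_
      obtain ⟨V, hV, hyV, hPV⟩ := F.exists_poincareOn_nhds hp y
      obtain ⟨z, hzV, U, hU, hx₀, hzU, hPU⟩ := mem_closure_iff.1 hy V hV hyV
      exact ⟨U ∪ V, hU.union hV, .inl hx₀, .inr hyV, hPU.union hp hPV (hUV hU hV hzU hzV)⟩
    · refine isOpen_iff_forall_mem_open.2 ?_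
      rintro x ⟨U, hU, hx₀, hx, hPU⟩
      exact ⟨U, fun y hy => ⟨U, hU, hx₀, hy, hPU⟩, hU, hx⟩
  have hSuniv : S = Set.univ := hS.eq_univ (by
    obtain ⟨U, hU, hx, hP⟩ := F.exists_poincareOn_nhds hp x₀
    exact ⟨x₀, U, hU, hx, hx, hP⟩)
  have key : ∃ U, IsOpen U ∧ x₀ ∈ U ∧ Set.univ ⊆ U ∧ F.PoincareOn F.bhMeasure p U := by
    refine isCompact_univ.induction_on
      (p := fun s : Set M => ∃ U, IsOpen U ∧ x₀ ∈ U ∧ s ⊆ U ∧ F.PoincareOn F.bhMeasure p U)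
      ?_ ?_ ?_ ?_
    · obtain ⟨U, hU, hx, hP⟩ := F.exists_poincareOn_nhds hp x₀
      exact ⟨U, hU, hx, Set.empty_subset _, hP⟩
    · rintro s t hst ⟨U, hU, hx, htU, hP⟩
      exact ⟨U, hU, hx, hst.trans htU, hP⟩
    · rintro s t ⟨U, hU, hxU, hsU, hPU⟩ ⟨V, hV, hxV, htV, hPV⟩
      exact ⟨U ∪ V, hU.union hV, .inl hxU, Set.union_subset_union hsU htV,
        hPU.union hp hPV (hUV hU hV hxU hxV)⟩
    · intro x _
      obtain ⟨U, hU, hx₀, hx, hP⟩ : x ∈ S := hSuniv ▸ Set.mem_univ x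
      exact ⟨U, mem_nhdsWithin_of_mem_nhds (hU.mem_nhds hx), U, hU, hx₀, le_rfl, hP⟩
  obtain ⟨U, -, -, hU, hP⟩ := key
  exact hP.mono hU

end FinslerMetric

section SignedPower

variable {p : ℝ}

theorem abs_rpow_sub_two_mul_of_nonneg (hp : 1 < p) {t : ℝ} (ht : 0 ≤ t) :
    |t| ^ (p - 2) * t = t ^ (p - 1) := by
  rcases ht.eq_or_lt with rfl | h
  · rw [Real.zero_rpow (by linarith), mul_zero]
  · rw [abs_of_pos h, show p - 1 = p - 2 + 1 by ring, Real.rpow_add_one h.ne']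

theorem abs_rpow_sub_two_mul_neg (t : ℝ) : |-t| ^ (p - 2) * -t = -(|t| ^ (p - 2) * t) := by
  rw [abs_neg, mul_neg]

theorem abs_signedPower (hp : 1 < p) (t : ℝ) : |(|t| ^ (p - 2) * t)| = |t| ^ (p - 1) := by
  rw [abs_mul, abs_of_nonneg (Real.rpow_nonneg (abs_nonneg t) _)]
  simpa using abs_rpow_sub_two_mul_of_nonneg hp (abs_nonneg t)

theorem monotone_signedPower (hp : 1 < p) : Monotone fun t : ℝ => |t| ^ (p - 2) * t := by
  refine monotone_of_odd_of_monotoneOn_nonneg (fun t => abs_rpow_sub_two_mul_neg t) ?_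
  intro s hs t ht hst
  simp only [abs_rpow_sub_two_mul_of_nonneg hp hs, abs_rpow_sub_two_mul_of_nonneg hp ht]
  exact Real.rpow_le_rpow hs hst (by linarith)

theorem continuous_signedPower (hp : 1 < p) : Continuous fun t : ℝ => |t| ^ (p - 2) * t := by
  refine continuous_iff_continuousAt.2 fun t => ?_
  rcases eq_or_ne t 0 with rfl | ht
  · have h0 : Tendsto (fun t : ℝ => |t| ^ (p - 1)) (𝓝 0) (𝓝 0) := by
      have : Continuous fun t : ℝ => |t| ^ (p - 1) :=
        continuous_abs.rpow_const fun _ => .inr (by linarith)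
      simpa [Real.zero_rpow (show p - 1 ≠ 0 by linarith)] using this.tendsto 0
    rw [ContinuousAt, mul_zero]
    exact squeeze_zero_norm (fun t => (abs_signedPower hp t).le) h0
  · exact (continuous_abs.continuousAt.rpow_const (.inl (abs_ne_zero.2 ht))).mul continuousAt_id

theorem abs_rpow_sub_le_abs_sub_rpow (hp : 1 < p) (a c : ℝ) :
    |a| ^ p - p * c * (|a| ^ (p - 2) * a) ≤ |a - c| ^ p := by
  have hpq := Real.HolderConjugate.conjExponent hp
  have h1 := Real.young_inequality (|a| ^ (p - 2) * a) (a - c) hpq.symm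
  have h2 : |(|a| ^ (p - 2) * a)| ^ p.conjExponent = |a| ^ p := by
    rw [abs_signedPower hp, ← Real.rpow_mul (abs_nonneg a)]
    congr 1
    exact hpq.sub_one_mul_conj
  have h3 : |a| ^ (p - 2) * a * a = |a| ^ p := by
    rcases eq_or_ne a 0 with rfl | ha
    · simp [Real.zero_rpow (show p ≠ 0 by linarith)]
    · rw [mul_assoc, ← sq, ← sq_abs, ← Real.rpow_natCast, ← Real.rpow_add (abs_pos.2 ha)]
      norm_num
  rw [h2, mul_sub, h3] at h1
  have h4 : p.conjExponent⁻¹ = 1 - p⁻¹ := by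
    have := hpq.inv_add_inv_eq_one
    linarith
  have hp0 : 0 < p := by linarith
  rw [div_eq_mul_inv, h4, div_eq_mul_inv] at h1
  have h5 := mul_le_mul_of_nonneg_left h1 hp0.le
  have h6 : p * (|a| ^ p * (1 - p⁻¹) + |a - c| ^ p * p⁻¹) =
      p * |a| ^ p - |a| ^ p + |a - c| ^ p := by
    field_simp
  rw [h6] at h5
  linarith

variable {Ω : Type*} [MeasurableSpace Ω] {μ : Measure Ω} {f : Ω → ℝ}

theorem MeasureTheory.MemLp.integrable_abs_rpow (hp : 1 < p)
    (hf : MemLp f (ENNReal.ofReal p) μ) : Integrable (fun x => |f x| ^ p) μ := by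
  have := hf.integrable_norm_rpow (by simpa using (by linarith : 0 < p)) ENNReal.ofReal_ne_top
  rwa [ENNReal.toReal_ofReal (by linarith)] at this

theorem integral_abs_rpow_pos (hp : 1 < p) (hf : MemLp f (ENNReal.ofReal p) μ)
    (hne : ¬ f =ᵐ[μ] 0) : 0 < ∫ x, |f x| ^ p ∂μ := by
  have h0 : 0 ≤ fun x => |f x| ^ p := fun x => Real.rpow_nonneg (abs_nonneg _) _
  refine lt_of_le_of_ne (integral_nonneg h0) fun h => hne ?_
  filter_upwards [(integral_eq_zero_iff_of_nonneg h0 (hf.integrable_abs_rpow hp)).1 h.symm]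
    with x hx
  simpa [Real.rpow_eq_zero (abs_nonneg (f x)) (show p ≠ 0 by linarith)] using hx

theorem integral_le_mul_of_measure_le {μ₀ : Measure Ω} {g : Ω → ℝ} (hg0 : 0 ≤ g) {c : ℝ} (hc : 0 ≤ c)
    (hμ : μ₀ ≤ ENNReal.ofReal c • μ) (hg : Integrable g μ) :
    ∫ x, g x ∂μ₀ ≤ c * ∫ x, g x ∂μ := by
  refine (integral_mono_measure hμ (ae_of_all _ hg0)
    (hg.smul_measure ENNReal.ofReal_ne_top)).trans ?_
  rw [integral_smul_measure, ENNReal.toReal_ofReal hc, smul_eq_mul]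

variable [IsFiniteMeasure μ]

theorem integrable_signedPower (hp : 1 < p) (hf : MemLp f (ENNReal.ofReal p) μ) :
    Integrable (fun x => |f x| ^ (p - 2) * f x) μ := by
  refine ((integrable_const (1 : ℝ)).add (hf.integrable_abs_rpow hp)).mono'
    ((continuous_signedPower hp).comp_aestronglyMeasurable hf.1) (ae_of_all _ fun x => ?_)
  rw [Real.norm_eq_abs, abs_signedPower hp]
  change _ ≤ 1 + |f x| ^ p
  rcases le_total |f x| 1 with h | h
  · have := Real.rpow_le_one (abs_nonneg (f x)) h (show 0 ≤ p - 1 by linarith)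
    have := Real.rpow_nonneg (abs_nonneg (f x)) p
    linarith
  · have := Real.rpow_le_rpow_of_exponent_le h (show p - 1 ≤ p by linarith)
    linarith

theorem memLp_sub_const (hf : MemLp f (ENNReal.ofReal p) μ) (c : ℝ) :
    MemLp (fun x => f x - c) (ENNReal.ofReal p) μ := hf.sub (memLp_const c)

theorem integral_abs_rpow_le_of_centred (hp : 1 < p) (hf : MemLp f (ENNReal.ofReal p) μ)
    (h0 : ∫ x, |f x| ^ (p - 2) * f x ∂μ = 0) (c : ℝ) :
    ∫ x, |f x| ^ p ∂μ ≤ ∫ x, |f x - c| ^ p ∂μ := by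
  have hi := hf.integrable_abs_rpow hp
  have hs := integrable_signedPower hp hf
  calc ∫ x, |f x| ^ p ∂μ = ∫ x, (|f x| ^ p - p * c * (|f x| ^ (p - 2) * f x)) ∂μ := by
        rw [integral_sub hi (hs.const_mul _), integral_const_mul, h0, mul_zero, sub_zero]
    _ ≤ _ := integral_mono (hi.sub (hs.const_mul _))
        ((memLp_sub_const hf c).integrable_abs_rpow hp)
        fun x => abs_rpow_sub_le_abs_sub_rpow hp (f x) c

theorem continuous_integral_signedPower_sub (hp : 1 < p) (hf : MemLp f (ENNReal.ofReal p) μ) :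
    Continuous fun c : ℝ => ∫ x, |f x - c| ^ (p - 2) * (f x - c) ∂μ := by
  refine continuous_iff_continuousAt.2 fun c₀ => ?_
  have hi := fun c => integrable_signedPower hp (memLp_sub_const hf c)
  refine continuousAt_of_dominated (bound := fun x =>
    |(|f x - (c₀ - 1)| ^ (p - 2) * (f x - (c₀ - 1)))| +
      |(|f x - (c₀ + 1)| ^ (p - 2) * (f x - (c₀ + 1)))|)
    (Eventually.of_forall fun c => (hi c).aestronglyMeasurable) ?_
    ((hi _).abs.add (hi _).abs) (ae_of_all _ fun x => ?_)
  · filter_upwards [Icc_mem_nhds (sub_one_lt c₀) (lt_add_one c₀)] with c hc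
    refine ae_of_all _ fun x => ?_
    have h1 := monotone_signedPower hp (show f x - c ≤ f x - (c₀ - 1) by linarith [hc.1])
    have h2 := monotone_signedPower hp (show f x - (c₀ + 1) ≤ f x - c by linarith [hc.2])
    simp only at h1 h2
    rw [Real.norm_eq_abs, abs_le]
    constructor
    · linarith [neg_abs_le (|f x - (c₀ + 1)| ^ (p - 2) * (f x - (c₀ + 1))),
        abs_nonneg (|f x - (c₀ - 1)| ^ (p - 2) * (f x - (c₀ - 1)))]
    · linarith [le_abs_self (|f x - (c₀ - 1)| ^ (p - 2) * (f x - (c₀ - 1))),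
        abs_nonneg (|f x - (c₀ + 1)| ^ (p - 2) * (f x - (c₀ + 1)))]
  · exact ((continuous_signedPower hp).comp (continuous_const.sub continuous_id)).continuousAt

theorem exists_integral_signedPower_sub_neg (hp : 1 < p) (hμ : μ ≠ 0)
    (hf : MemLp f (ENNReal.ofReal p) μ) :
    ∃ c : ℝ, ∫ x, |f x - c| ^ (p - 2) * (f x - c) ∂μ < 0 := by
  have hi := fun c => integrable_signedPower hp (memLp_sub_const hf c)
  have hmax : ∀ k : ℕ, Integrable
      (fun x => max (|f x - k| ^ (p - 2) * (f x - k)) (-1)) μ := fun k =>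
    (hi k).sup (integrable_const _)
  have hlim : Tendsto (fun k : ℕ => ∫ x, max (|f x - k| ^ (p - 2) * (f x - k)) (-1) ∂μ) atTop
      (𝓝 (∫ _, (-1 : ℝ) ∂μ)) := by
    refine tendsto_integral_of_dominated_convergence
      (fun x => |(|f x| ^ (p - 2) * f x)| + 1) (fun k => (hmax k).aestronglyMeasurable)
      ((integrable_signedPower hp hf).abs.add (integrable_const _))
      (fun k => ae_of_all _ fun x => ?_) (ae_of_all _ fun x => ?_)
    · have h1 := monotone_signedPower hp
        (show f x - k ≤ f x by linarith [Nat.cast_nonneg (α := ℝ) k])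
      simp only at h1
      have h2 := le_abs_self (|f x| ^ (p - 2) * f x)
      rw [Real.norm_eq_abs, abs_le]
      exact ⟨by linarith [le_max_right (|f x - k| ^ (p - 2) * (f x - k)) (-1),
        abs_nonneg (|f x| ^ (p - 2) * f x)],
        max_le (by linarith) (by linarith [abs_nonneg (|f x| ^ (p - 2) * f x)])⟩
    · refine tendsto_const_nhds.congr' ?_
      obtain ⟨N, hN⟩ := exists_nat_ge (f x + 1)
      filter_upwards [eventually_ge_atTop N] with k hk
      have hk' : (N : ℝ) ≤ k := by exact_mod_cast hk
      have h1 := monotone_signedPower hp (show f x - k ≤ -1 by linarith)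
      simp only [abs_neg, abs_one, Real.one_rpow, one_mul] at h1
      exact (max_eq_right h1).symm
  have hneg : ∫ _, (-1 : ℝ) ∂μ < 0 := by
    have : 0 < μ.real Set.univ := by
      rw [measureReal_def]
      exact ENNReal.toReal_pos (by simpa using hμ) (measure_ne_top _ _)
    simpa using this
  obtain ⟨k, hk⟩ := (hlim.eventually (gt_mem_nhds hneg)).exists
  exact ⟨k, (integral_mono (hi k) (hmax k) fun x => le_max_left _ _).trans_lt hk⟩

theorem exists_integral_signedPower_sub_eq_zero (hp : 1 < p)
    (hf : MemLp f (ENNReal.ofReal p) μ) :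
    ∃ c : ℝ, ∫ x, |f x - c| ^ (p - 2) * (f x - c) ∂μ = 0 := by
  rcases eq_or_ne μ 0 with rfl | hμ
  · exact ⟨0, by simp⟩
  obtain ⟨a, ha⟩ := exists_integral_signedPower_sub_neg hp hμ hf
  obtain ⟨b, hb⟩ := exists_integral_signedPower_sub_neg hp hμ hf.neg
  have hb' : 0 ≤ ∫ x, |f x - -b| ^ (p - 2) * (f x - -b) ∂μ := by
    have h1 : ∀ x, |(-f) x - b| ^ (p - 2) * ((-f) x - b) =
        -(|f x - -b| ^ (p - 2) * (f x - -b)) := fun x => by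
      rw [← abs_rpow_sub_two_mul_neg, Pi.neg_apply, show -f x - b = -(f x - -b) by ring]
    simp_rw [h1] at hb
    rw [integral_neg] at hb
    linarith
  exact mem_range_of_exists_le_of_exists_ge (continuous_integral_signedPower_sub hp hf)
    ⟨a, ha.le⟩ ⟨-b, hb'⟩

end SignedPower

theorem MeasureTheory.tendsto_eLpNorm_of_measure_le {M : Type*} [MeasurableSpace M]
    {μ μ₀ : Measure M} {c q : ℝ≥0∞} (hc : c ≠ ⊤) (hq : q ≠ ⊤)
    (hμ : μ₀ ≤ c • μ)
    {g : ℕ → M → ℝ} (h : Tendsto (fun k => eLpNorm (g k) q μ) atTop (𝓝 0)) :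
    Tendsto (fun k => eLpNorm (g k) q μ₀) atTop (𝓝 0) := by
  have h1 : Tendsto (fun k => c ^ (1 / q).toReal * eLpNorm (g k) q μ) atTop (𝓝 0) := by
    have := ENNReal.Tendsto.const_mul (a := c ^ (1 / q).toReal) h (.inr (by finiteness))
    rwa [mul_zero] at this
  refine tendsto_of_tendsto_of_tendsto_of_le_of_le tendsto_const_nhds h1 (fun k => zero_le)
    fun k => (eLpNorm_mono_measure _ hμ).trans ?_
  rw [eLpNorm_smul_measure_of_ne_top hq, smul_eq_mul]

section Differential

variable {n : ℕ} {M : Type*} [TopologicalSpace M] [ChartedSpace (EuclideanSpace ℝ (Fin n)) M]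

theorem differential_sub {u v : M → ℝ} (hu : ContMDiff (𝓡 n) 𝓘(ℝ, ℝ) ∞ u)
    (hv : ContMDiff (𝓡 n) 𝓘(ℝ, ℝ) ∞ v) (x : M) :
    differential (n := n) (fun y => u y - v y) x = differential u x - differential v x :=
  mfderiv_sub (hu.mdifferentiableAt (by simp)) (hv.mdifferentiableAt (by simp))

theorem differential_const (c : ℝ) (x : M) : differential (n := n) (fun _ : M => c) x = 0 :=
  mfderiv_const

theorem differential_sub_const {u : M → ℝ} (hu : ContMDiff (𝓡 n) 𝓘(ℝ, ℝ) ∞ u) (c : ℝ) (x : M) :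
    differential (n := n) (fun y => u y - c) x = differential u x := by
  rw [differential_sub hu contMDiff_const, differential_const, sub_zero]

end Differential

namespace FinslerMetric

section Sobolev

variable {n : ℕ} {M : Type*} [TopologicalSpace M]
  [ChartedSpace (EuclideanSpace ℝ (Fin n)) M] [IsManifold (𝓡 n) ∞ M]
  {F : FinslerMetric n M} (F₀ : FinslerMetric n M)

theorem exists_dual_comparison (F : FinslerMetric n M) (x : M) : ∃ C : ℝ, 0 ≤ C ∧
    ∀ α : TangentSpace (𝓡 n) x →L[ℝ] ℝ,
      F₀.dual x α ≤ C * F.dual x α ∧ F₀.dual x (-α) ≤ C * F.dual x α := by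
  obtain ⟨a, b, ha, -, h₀⟩ := F₀.exists_fibre_bounds x
  obtain ⟨_, b', -, hb', h⟩ := F.exists_fibre_bounds x
  obtain ⟨R, hR, hrev⟩ := F.exists_reversibility_fibre x
  have h1 : ∀ v : TangentSpace (𝓡 n) x, F ⟨x, v⟩ ≤ b' / a * F₀ ⟨x, v⟩ := fun v =>
    calc F ⟨x, v⟩ ≤ b' * ‖tangentCoord x v‖ := (h v).2
      _ = b' / a * (a * ‖tangentCoord x v‖) := by field_simp
      _ ≤ b' / a * F₀ ⟨x, v⟩ := by gcongr; exact (h₀ v).1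
  have hC : 0 ≤ b' / a := by positivity
  refine ⟨max (b' / a) (b' / a * R), le_max_of_le_left hC, fun α => ⟨?_, ?_⟩⟩
  · exact (F₀.dual_le_mul_dual F hC x h1 α).trans
      (mul_le_mul_of_nonneg_right (le_max_left _ _) (F.dual_nonneg x α))
  · refine (F₀.dual_le_mul_dual F hC x h1 (-α)).trans (le_trans ?_
      (mul_le_mul_of_nonneg_right (le_max_right _ _) (F.dual_nonneg x α)))
    rw [mul_assoc]
    exact mul_le_mul_of_nonneg_left (F.dual_neg_le hR x hrev α) hC

/-- The dual of one metric is continuous for the convergence defined by the dual of another. -/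
theorem tendsto_dual_sub (F : FinslerMetric n M) {x : M} {α β : TangentSpace (𝓡 n) x →L[ℝ] ℝ}
    {γ : ℕ → TangentSpace (𝓡 n) x →L[ℝ] ℝ}
    (h : Tendsto (fun k => F.dual x (α - γ k)) atTop (𝓝 0)) :
    Tendsto (fun k => F₀.dual x (γ k - β)) atTop (𝓝 (F₀.dual x (α - β))) := by
  obtain ⟨C, hC, hdual⟩ := exists_dual_comparison F₀ F x
  rw [tendsto_iff_dist_tendsto_zero]
  have h0 : Tendsto (fun k => C * F.dual x (α - γ k)) atTop (𝓝 0) := by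
    simpa using h.const_mul C
  refine squeeze_zero (fun k => dist_nonneg) (fun k => ?_) h0
  have h1 := F₀.dual_add_le x (α - γ k) (γ k - β)
  have h2 := F₀.dual_add_le x (-(α - γ k)) (α - β)
  rw [sub_add_sub_cancel] at h1
  rw [neg_sub, sub_add_sub_cancel] at h2
  have h3 := (hdual (α - γ k)).1
  have h4 := (hdual (α - γ k)).2
  rw [neg_sub] at h4
  rw [Real.dist_eq, abs_le]
  constructor <;> linarith

theorem energy_eq (F : FinslerMetric n M) [MeasurableSpace M] (μ : Measure M) (p : ℝ)
    (f : M → ℝ) (α : ∀ x : M, TangentSpace (𝓡 n) x →L[ℝ] ℝ) :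
    F.energy μ p f α = (∫ x, F.dual x (α x) ^ p ∂μ) / ∫ x, |f x| ^ p ∂μ := by
  simp only [energy, map_legendre]

theorem energy_nonneg (F : FinslerMetric n M) [MeasurableSpace M] (μ : Measure M) (p : ℝ)
    (f : M → ℝ) (α : ∀ x : M, TangentSpace (𝓡 n) x →L[ℝ] ℝ) : 0 ≤ F.energy μ p f α := by
  rw [energy_eq]
  exact div_nonneg (integral_nonneg fun x => Real.rpow_nonneg (F.dual_nonneg _ _) _)
    (integral_nonneg fun x => Real.rpow_nonneg (abs_nonneg _) _)

variable [MeasurableSpace M] {μ μ₀ : Measure M} {p : ℝ} {f : M → ℝ}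
  {α : ∀ x : M, TangentSpace (𝓡 n) x →L[ℝ] ℝ}

theorem firstEigenvalueWith_le_energy (h : F.IsSobolev μ p f α) (hne : ¬ f =ᵐ[μ] 0)
    (h0 : ∫ x, |f x| ^ (p - 2) * f x ∂μ = 0) : F.firstEigenvalueWith μ p ≤ F.energy μ p f α := by
  refine csInf_le ⟨0, ?_⟩ ⟨f, α, h, hne, h0, rfl⟩
  rintro _ ⟨f, α, -, -, -, rfl⟩
  exact energy_nonneg _ _ _ _ _

variable [BorelSpace M]

theorem IsSobolev.aestronglyMeasurable_dual_sub (hp : 1 < p) (h : F.IsSobolev μ p f α) {w : M → ℝ}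
    (hw : ContMDiff (𝓡 n) 𝓘(ℝ, ℝ) ∞ w) :
    AEStronglyMeasurable (fun x => F₀.dual x (α x - differential w x)) μ := by
  obtain ⟨-, u, hu, -, hmem, hlim⟩ := h
  have hp0 : ENNReal.ofReal p ≠ 0 := by simpa using (by linarith : 0 < p)
  have hmeas : TendstoInMeasure μ (fun k x => F.dual x (α x - differential (u k) x)) atTop 0 :=
    tendstoInMeasure_of_tendsto_eLpNorm hp0 (fun k => (hmem k).1) aestronglyMeasurable_zero
      (by simpa using hlim)
  obtain ⟨ns, -, hns⟩ := hmeas.exists_seq_tendsto_ae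
  refine aestronglyMeasurable_of_tendsto_ae atTop
    (f := fun k x => F₀.dual x (differential (u (ns k)) x - differential w x)) (fun k => ?_) ?_
  · simp_rw [← differential_sub (hu (ns k)) hw]
    exact (F₀.continuous_dual_differential ((hu (ns k)).sub hw)).aestronglyMeasurable
  · filter_upwards [hns] with x hx
    exact tendsto_dual_sub F₀ F hx

theorem IsSobolev.aestronglyMeasurable_dual (hp : 1 < p) (h : F.IsSobolev μ p f α) :
    AEStronglyMeasurable (fun x => F₀.dual x (α x)) μ := by
  have := h.aestronglyMeasurable_dual_sub F₀ hp (w := fun _ => 0) contMDiff_const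
  simpa [differential_const] using this

theorem memLp_of_continuous [CompactSpace M] [IsFiniteMeasure μ] {g : M → ℝ}
    (hg : Continuous g) (q : ℝ≥0∞) : MemLp g q μ :=
  hg.memLp_of_hasCompactSupport (HasCompactSupport.of_compactSpace g)

theorem IsSobolev.memLp_dual [CompactSpace M] [IsFiniteMeasure μ] (hp : 1 < p)
    (h : F.IsSobolev μ p f α) : MemLp (fun x => F.dual x (α x)) (ENNReal.ofReal p) μ := by
  have hmeas := h.aestronglyMeasurable_dual F hp
  obtain ⟨-, u, hu, -, hmem, -⟩ := h
  have h2 := memLp_of_continuous (μ := μ) (F.continuous_dual_differential (hu 0))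
    (ENNReal.ofReal p)
  refine ((hmem 0).add h2).mono' hmeas (ae_of_all _ fun x => ?_)
  rw [Real.norm_of_nonneg (F.dual_nonneg _ _)]
  have := F.dual_add_le x (α x - differential (u 0) x) (differential (u 0) x)
  rwa [sub_add_cancel] at this

theorem IsSobolev.transfer [IsFiniteMeasure μ] (hp : 1 < p) {C : ℝ} (hC : 0 ≤ C)
    (hF : ∀ v, F v ≤ C * F₀ v) {c : ℝ≥0∞} (hc : c ≠ ⊤) (hμ : μ₀ ≤ c • μ)
    (h : F.IsSobolev μ p f α) (t : ℝ) : F₀.IsSobolev μ₀ p (fun x => f x - t) α := by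
  have hmeas := fun (w : M → ℝ) (hw : ContMDiff (𝓡 n) 𝓘(ℝ, ℝ) ∞ w) =>
    h.aestronglyMeasurable_dual_sub F₀ hp hw
  obtain ⟨hf, u, hu, hlim, hmem, hdlim⟩ := h
  have hle : ∀ k x, ‖F₀.dual x (α x - differential (u k) x)‖ ≤
      C * ‖F.dual x (α x - differential (u k) x)‖ := fun k x => by
    rw [Real.norm_of_nonneg (F.dual_nonneg _ _), Real.norm_of_nonneg (F₀.dual_nonneg _ _)]
    exact F₀.dual_le_mul_dual F hC x (fun v => hF _) _
  refine ⟨(memLp_sub_const hf t).of_measure_le_smul hc hμ, fun k x => u k x - t,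
    fun k => (hu k).sub contMDiff_const, ?_, fun k => ?_, ?_⟩
  · simp_rw [sub_sub_sub_cancel_right]
    exact tendsto_eLpNorm_of_measure_le hc ENNReal.ofReal_ne_top hμ hlim
  · simp_rw [differential_sub_const (hu k)]
    exact ((hmem k).of_le_mul (hmeas _ (hu k)) (ae_of_all _ (hle k))).of_measure_le_smul hc hμ
  · simp_rw [fun k => differential_sub_const (hu k) t]
    refine tendsto_eLpNorm_of_measure_le hc ENNReal.ofReal_ne_top hμ ?_
    have h1 := ENNReal.Tendsto.const_mul (a := ENNReal.ofReal C) hdlim (.inr (by finiteness))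
    rw [mul_zero] at h1
    exact tendsto_of_tendsto_of_tendsto_of_le_of_le tendsto_const_nhds h1 (fun k => zero_le)
      fun k => eLpNorm_le_mul_eLpNorm_of_ae_le_mul (ae_of_all _ (hle k)) _

end Sobolev

end FinslerMetric

theorem nontrivial_of_chartedSpace {n : ℕ} (hn : 1 ≤ n) (M : Type*) [TopologicalSpace M]
    [ChartedSpace (EuclideanSpace ℝ (Fin n)) M] [Nonempty M] : Nontrivial M := by
  by_contra h
  rw [not_nontrivial_iff_subsingleton] at h
  obtain ⟨x₀⟩ := (inferInstance : Nonempty M)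
  have : Nonempty (Fin n) := ⟨⟨0, hn⟩⟩
  have h1 : (chartAt (EuclideanSpace ℝ (Fin n)) x₀).target =
      {chartAt (EuclideanSpace ℝ (Fin n)) x₀ x₀} := by
    refine Set.eq_singleton_iff_unique_mem.2 ⟨mem_chart_target _ x₀, fun y hy => ?_⟩
    rw [← (chartAt (EuclideanSpace ℝ (Fin n)) x₀).right_inv hy]
    congr 1
    exact Subsingleton.elim _ _
  have h2 := (chartAt (EuclideanSpace ℝ (Fin n)) x₀).open_target
  rw [h1] at h2
  exact not_isOpen_singleton _ h2

theorem exists_contMDiff_ne {n : ℕ} (hn : 1 ≤ n) (M : Type*) [TopologicalSpace M]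
    [ChartedSpace (EuclideanSpace ℝ (Fin n)) M] [IsManifold (𝓡 n) ∞ M] [CompactSpace M]
    [T2Space M] [Nonempty M] :
    ∃ (u : M → ℝ) (x y : M), ContMDiff (𝓡 n) 𝓘(ℝ, ℝ) ∞ u ∧ u x ≠ u y := by
  have := nontrivial_of_chartedSpace hn M
  obtain ⟨x, y, hxy⟩ := exists_pair_ne M
  obtain ⟨u, hu, -, h0, h1⟩ := exists_contMDiff_zero_iff_one_iff_of_isClosed (𝓡 n) (n := ⊤)
    (isClosed_singleton (x := x)) (isClosed_singleton (x := y)) (by simpa using hxy)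
  refine ⟨u, x, y, hu, ?_⟩
  rw [(h0 x).1 rfl, (h1 y).1 rfl]
  exact zero_ne_one

namespace FinslerMetric

variable {n : ℕ} {M : Type*} [TopologicalSpace M]
  [ChartedSpace (EuclideanSpace ℝ (Fin n)) M] [IsManifold (𝓡 n) ∞ M]
  [MeasurableSpace M] [BorelSpace M] [CompactSpace M]
  {F F₀ : FinslerMetric n M} {μ μ₀ : Measure M} {p : ℝ} {f : M → ℝ}
  {α : ∀ x : M, TangentSpace (𝓡 n) x →L[ℝ] ℝ}

theorem IsSobolev.integrable_dual_rpow [IsFiniteMeasure μ] (hp : 1 < p)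
    (h : F.IsSobolev μ p f α) : Integrable (fun x => F.dual x (α x) ^ p) μ := by
  simpa [abs_of_nonneg (F.dual_nonneg _ _)] using (h.memLp_dual hp).integrable_abs_rpow hp

/-- Comparison of an eigenvalue with the energies of a bi-Lipschitz equivalent metric. -/
theorem firstEigenvalueWith_le_mul_energy [IsFiniteMeasure μ] [IsFiniteMeasure μ₀] (hp : 1 < p)
    {C c : ℝ} (hC : 0 < C) (hc : 0 < c) (hF : ∀ v, F v ≤ C * F₀ v)
    (hμ₀ : μ₀ ≤ ENNReal.ofReal c • μ) (hμ : μ ≤ ENNReal.ofReal c • μ₀)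
    (h : F.IsSobolev μ p f α) (hne : ¬ f =ᵐ[μ] 0) (h0 : ∫ x, |f x| ^ (p - 2) * f x ∂μ = 0) :
    F₀.firstEigenvalueWith μ₀ p ≤ c ^ 2 * C ^ p * F.energy μ p f α := by
  obtain ⟨t, ht⟩ := exists_integral_signedPower_sub_eq_zero hp
    (h.1.of_measure_le_smul ENNReal.ofReal_ne_top hμ₀)
  have hS : F₀.IsSobolev μ₀ p (fun x => f x - t) α :=
    h.transfer F₀ hp hC.le hF ENNReal.ofReal_ne_top hμ₀ t
  set D := ∫ x, |f x| ^ p ∂μ with hD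
  set D₀ := ∫ x, |f x - t| ^ p ∂μ₀ with hD₀
  have hDpos : 0 < D := integral_abs_rpow_pos hp h.1 hne
  have hDD : D ≤ c * D₀ := (integral_abs_rpow_le_of_centred hp h.1 h0 t).trans
    (integral_le_mul_of_measure_le (fun x => Real.rpow_nonneg (abs_nonneg _) _) hc.le hμ
      (hS.1.integrable_abs_rpow hp))
  have hD₀pos : 0 < D₀ := pos_of_mul_pos_right (hDpos.trans_le hDD) hc.le
  have hne' : ¬ (fun x => f x - t) =ᵐ[μ₀] 0 := fun h' => by
    have : D₀ = 0 := integral_eq_zero_of_ae (by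
      filter_upwards [h'] with x hx
      rw [hx]
      simp [Real.zero_rpow (show p ≠ 0 by linarith)])
    exact hD₀pos.ne' this
  refine (firstEigenvalueWith_le_energy hS hne' ht).trans ?_
  rw [energy_eq, energy_eq, ← hD, ← hD₀, div_le_iff₀ hD₀pos]
  set N := ∫ x, F.dual x (α x) ^ p ∂μ with hN
  have hNN : ∫ x, F₀.dual x (α x) ^ p ∂μ₀ ≤ c * (C ^ p * N) := by
    have hint := h.integrable_dual_rpow hp
    have hle : ∀ x, F₀.dual x (α x) ^ p ≤ C ^ p * F.dual x (α x) ^ p := fun x => by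
      rw [← Real.mul_rpow hC.le (F.dual_nonneg _ _)]
      exact Real.rpow_le_rpow (F₀.dual_nonneg _ _)
        (F₀.dual_le_mul_dual F hC.le x (fun v => hF _) _) (by linarith)
    have hint₀ : Integrable (fun x => F.dual x (α x) ^ p) μ₀ :=
      hint.of_measure_le_smul ENNReal.ofReal_ne_top hμ₀
    have hN₀ := integral_le_mul_of_measure_le (fun x => Real.rpow_nonneg (F.dual_nonneg _ _) _)
      hc.le hμ₀ hint
    calc ∫ x, F₀.dual x (α x) ^ p ∂μ₀ ≤ ∫ x, C ^ p * F.dual x (α x) ^ p ∂μ₀ :=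
          integral_mono (hS.integrable_dual_rpow hp) (hint₀.const_mul _) hle
      _ = C ^ p * ∫ x, F.dual x (α x) ^ p ∂μ₀ := integral_const_mul _ _
      _ ≤ C ^ p * (c * N) := by gcongr
      _ = _ := by ring
  have hN0 : 0 ≤ N := integral_nonneg fun x => Real.rpow_nonneg (F.dual_nonneg _ _) _
  calc ∫ x, F₀.dual x (α x) ^ p ∂μ₀ ≤ c * (C ^ p * N) := hNN
    _ = c * (C ^ p * N) * (D / D) := by rw [div_self hDpos.ne', mul_one]
    _ ≤ c * (C ^ p * N) * (c * D₀ / D) := by gcongr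
    _ = _ := by ring

theorem exists_poincare_sobolev [ConnectedSpace M] (F : FinslerMetric n M) (hp : 1 < p) :
    ∃ A : ℝ≥0∞, A ≠ ⊤ ∧ ∀ (f : M → ℝ) (α : ∀ x : M, TangentSpace (𝓡 n) x →L[ℝ] ℝ),
      F.IsSobolev F.bhMeasure p f α → ∫ x, |f x| ^ (p - 2) * f x ∂F.bhMeasure = 0 →
      eLpNorm f (ENNReal.ofReal p) F.bhMeasure ≤
        A * eLpNorm (fun x => F.dual x (α x)) (ENNReal.ofReal p) F.bhMeasure := by
  have hfin := F.isFiniteMeasure_bhMeasure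
  obtain ⟨A, hA, hPoin⟩ := F.poincareOn_univ hp.le
  obtain ⟨R, hR, hrev⟩ := F.exists_reversibility
  set μ := F.bhMeasure
  have hp0 : 0 < p := by linarith
  set q := ENNReal.ofReal p with hq
  have hqp : q.toReal = p := ENNReal.toReal_ofReal hp0.le
  have hq0 : q ≠ 0 := by simpa [hq] using hp0
  have hqt : q ≠ ⊤ := ENNReal.ofReal_ne_top
  have hq1 : 1 ≤ q := by simpa [hq] using hp.le
  have hB : A ^ (1 / p) ≠ ⊤ := by finiteness
  refine ⟨A ^ (1 / p), hB, fun f α h h0 => ?_⟩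
  have hd := h.memLp_dual hp
  obtain ⟨hf, u, hu, hlim, hmem, hdlim⟩ := h
  have hle : ∀ k, eLpNorm f q μ ≤ eLpNorm (fun x => f x - u k x) q μ +
      A ^ (1 / p) * (eLpNorm (fun x => F.dual x (α x)) q μ +
        ENNReal.ofReal R * eLpNorm (fun x => F.dual x (α x - differential (u k) x)) q μ) := by
    intro k
    obtain ⟨c, hc⟩ := hPoin (u k) (hu k)
    have h1 : eLpNorm f q μ ≤ eLpNorm (fun x => f x - c) q μ := by
      rw [hf.eLpNorm_eq_integral_rpow_norm hq0 hqt,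
        (memLp_sub_const hf c).eLpNorm_eq_integral_rpow_norm hq0 hqt, hqp]
      apply ENNReal.ofReal_le_ofReal
      refine Real.rpow_le_rpow
        (integral_nonneg fun x => Real.rpow_nonneg (norm_nonneg _) _) ?_ (by positivity)
      exact integral_abs_rpow_le_of_centred hp hf h0 c
    have hum := memLp_of_continuous (μ := μ) (hu k).continuous q
    have h2 : eLpNorm (fun x => f x - c) q μ ≤
        eLpNorm (fun x => f x - u k x) q μ + eLpNorm (fun x => u k x - c) q μ := by
      have h3 := eLpNorm_add_le (hf.sub hum).1 (memLp_sub_const hum c).1 hq1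
      have h4 : (f - u k + fun x => u k x - c) = fun x => f x - c := by
        ext x
        simp
      rw [h4] at h3
      exact h3
    have h3 : eLpNorm (fun x => u k x - c) q μ ≤
        A ^ (1 / p) * eLpNorm (fun x => F.dual x (differential (u k) x)) q μ := by
      rw [eLpNorm_eq_lintegral_rpow_enorm_toReal hq0 hqt,
        eLpNorm_eq_lintegral_rpow_enorm_toReal hq0 hqt, hqp,
        ← ENNReal.mul_rpow_of_nonneg _ _ (by positivity)]
      gcongr
      simpa using hc
    have h4 : eLpNorm (fun x => F.dual x (differential (u k) x)) q μ ≤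
        eLpNorm (fun x => F.dual x (α x)) q μ +
        ENNReal.ofReal R * eLpNorm (fun x => F.dual x (α x - differential (u k) x)) q μ := by
      have h5 : eLpNorm (R • fun x => F.dual x (α x - differential (u k) x)) q μ =
          ENNReal.ofReal R * eLpNorm (fun x => F.dual x (α x - differential (u k) x)) q μ := by
        rw [eLpNorm_const_smul, Real.enorm_of_nonneg hR]
      rw [← h5]
      refine (eLpNorm_mono_real fun x => ?_).trans
        (eLpNorm_add_le hd.1 ((hmem k).1.const_smul R) hq1)
      rw [Real.norm_of_nonneg (F.dual_nonneg _ _)]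
      have h6 := F.dual_add_le x (α x) (-(α x - differential (u k) x))
      have h7 := F.dual_neg_le hR x (hrev x) (α x - differential (u k) x)
      have h8 : α x + -(α x - differential (u k) x) = differential (u k) x := by abel
      rw [h8] at h6
      exact h6.trans (by simpa using h7)
    calc eLpNorm f q μ ≤ _ := h1
      _ ≤ _ := h2
      _ ≤ _ := add_le_add_right (h3.trans (mul_le_mul_right h4 _)) _
  have hlim' : Tendsto (fun k => eLpNorm (fun x => f x - u k x) q μ +
      A ^ (1 / p) * (eLpNorm (fun x => F.dual x (α x)) q μ +
        ENNReal.ofReal R * eLpNorm (fun x => F.dual x (α x - differential (u k) x)) q μ))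
      atTop (𝓝 (0 + A ^ (1 / p) * (eLpNorm (fun x => F.dual x (α x)) q μ +
        ENNReal.ofReal R * 0))) :=
    hlim.add (ENNReal.Tendsto.const_mul
      (tendsto_const_nhds.add (ENNReal.Tendsto.const_mul hdlim (.inr ENNReal.ofReal_ne_top)))
      (.inr hB))
  have := ge_of_tendsto' hlim' hle
  simpa using this

theorem exists_pos_le_energy [ConnectedSpace M] (F : FinslerMetric n M) (hp : 1 < p) :
    ∃ δ : ℝ, 0 < δ ∧ ∀ (f : M → ℝ) (α : ∀ x : M, TangentSpace (𝓡 n) x →L[ℝ] ℝ),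
      F.IsSobolev F.bhMeasure p f α → ¬ f =ᵐ[F.bhMeasure] 0 →
      ∫ x, |f x| ^ (p - 2) * f x ∂F.bhMeasure = 0 → δ ≤ F.energy F.bhMeasure p f α := by
  have hfin := F.isFiniteMeasure_bhMeasure
  obtain ⟨A, hA, hPoin⟩ := F.exists_poincare_sobolev hp
  have hp0 : 0 < p := by linarith
  set a := A.toReal + 1 with ha
  have ha0 : 0 < a := by positivity
  have hAa : A ≤ ENNReal.ofReal a :=
    (ENNReal.le_ofReal_iff_toReal_le hA ha0.le).2 (by linarith)
  refine ⟨(a ^ p)⁻¹, by positivity, fun f α h hne h0 => ?_⟩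
  have hP := (hPoin f α h h0).trans (mul_le_mul_left hAa _)
  have hq0 : ENNReal.ofReal p ≠ 0 := by simpa using hp0
  rw [h.1.eLpNorm_eq_integral_rpow_norm hq0 ENNReal.ofReal_ne_top,
    (h.memLp_dual hp).eLpNorm_eq_integral_rpow_norm hq0 ENNReal.ofReal_ne_top,
    ENNReal.toReal_ofReal hp0.le, ← ENNReal.ofReal_mul ha0.le] at hP
  simp only [Real.norm_eq_abs, abs_of_nonneg (F.dual_nonneg _ _)] at hP
  have hD := integral_abs_rpow_pos hp h.1 hne
  have hN : 0 ≤ ∫ x, F.dual x (α x) ^ p ∂F.bhMeasure :=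
    integral_nonneg fun x => Real.rpow_nonneg (F.dual_nonneg _ _) _
  rw [ENNReal.ofReal_le_ofReal_iff (by positivity)] at hP
  have hP' := Real.rpow_le_rpow (by positivity) hP hp0.le
  rw [Real.mul_rpow ha0.le (by positivity), Real.rpow_inv_rpow hD.le hp0.ne',
    Real.rpow_inv_rpow hN hp0.ne'] at hP'
  rw [energy_eq, le_div_iff₀ hD, inv_mul_le_iff₀ (by positivity)]
  exact hP'

theorem exists_admissible (hn : 1 ≤ n) [T2Space M] [ConnectedSpace M] (F : FinslerMetric n M)
    (hp : 1 < p) : ∃ (f : M → ℝ) (α : ∀ x : M, TangentSpace (𝓡 n) x →L[ℝ] ℝ),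
      F.IsSobolev F.bhMeasure p f α ∧ ¬ f =ᵐ[F.bhMeasure] 0 ∧
      ∫ x, |f x| ^ (p - 2) * f x ∂F.bhMeasure = 0 := by
  have hfin := F.isFiniteMeasure_bhMeasure
  have hopen := F.isOpenPosMeasure_bhMeasure
  obtain ⟨u, x, y, hu, hxy⟩ := exists_contMDiff_ne hn M
  have hum := memLp_of_continuous (μ := F.bhMeasure) hu.continuous (ENNReal.ofReal p)
  obtain ⟨c, hc⟩ := exists_integral_signedPower_sub_eq_zero hp hum
  refine ⟨fun x => u x - c, differential fun x => u x - c,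
    ⟨memLp_sub_const hum c, fun _ x => u x - c, fun _ => hu.sub contMDiff_const, ?_, ?_, ?_⟩,
    fun h => hxy ?_, hc⟩
  · simp
  · simp [F.dual_zero]
  · simp [F.dual_zero]
  · have h1 := (Continuous.ae_eq_iff_eq F.bhMeasure (hu.continuous.sub continuous_const)
      continuous_zero).1 h
    have h2 : u x - c = 0 := congrFun h1 x
    have h3 : u y - c = 0 := congrFun h1 y
    linarith

theorem firstEigenvalue_pos (hn : 1 ≤ n) [T2Space M] [ConnectedSpace M] (F : FinslerMetric n M)
    (hp : 1 < p) : 0 < F.firstEigenvalue p := by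
  obtain ⟨δ, hδ, h⟩ := F.exists_pos_le_energy hp
  obtain ⟨f, α, h1, h2, h3⟩ := F.exists_admissible hn hp
  refine hδ.trans_le (le_csInf ⟨_, f, α, h1, h2, h3, rfl⟩ ?_)
  rintro _ ⟨f, α, h1, h2, h3, rfl⟩
  exact h f α h1 h2 h3

theorem firstEigenvalue_le_mul (hn : 1 ≤ n) [T2Space M] [ConnectedSpace M] (hp : 1 < p) {C : ℝ}
    (hC : 0 < C) (h : ∀ v, F v ≤ C * F₀ v) (h₀ : ∀ v, F₀ v ≤ C * F v) :
    F₀.firstEigenvalue p ≤ C ^ (p + 2 * n) * F.firstEigenvalue p := by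
  have hfin := F.isFiniteMeasure_bhMeasure
  have hfin₀ := F₀.isFiniteMeasure_bhMeasure
  obtain ⟨f, α, h1, h2, h3⟩ := F.exists_admissible hn hp
  have hCp : C ^ (p + 2 * n) = (C ^ n) ^ 2 * C ^ p := by
    rw [Real.rpow_add hC, mul_comm, ← pow_mul, mul_comm n 2]
    congr 1
    exact_mod_cast Real.rpow_natCast C (2 * n)
  rw [← div_le_iff₀' (by positivity)]
  refine le_csInf ⟨_, f, α, h1, h2, h3, rfl⟩ ?_
  rintro _ ⟨f, α, h1, h2, h3, rfl⟩
  rw [div_le_iff₀' (by positivity), hCp]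
  exact firstEigenvalueWith_le_mul_energy hp hC (by positivity) h
    (F₀.bhMeasure_le_smul F hC h₀) (F.bhMeasure_le_smul F₀ hC h) h1 h2 h3

end FinslerMetric

theorem mainTheorem4 (n : ℕ) (hn : 1 ≤ n) (p : ℝ) (hp : 1 < p) (κ κ₀ : ℝ≥0∞) :
    ∃ K : ℝ, 1 ≤ K ∧
      ∀ (M : Type*) [TopologicalSpace M] [ChartedSpace (EuclideanSpace ℝ (Fin n)) M]
        [IsManifold (𝓡 n) ∞ M] [T2Space M] [CompactSpace M] [ConnectedSpace M]
        [MeasurableSpace M] [BorelSpace M]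
        (F F₀ : FinslerMetric n M) (C : ℝ),
        F.reversibility = κ → F₀.reversibility = κ₀ → FinslerMetric.BiLipschitz C F F₀ →
          C ^ (-K) ≤ F.firstEigenvalue p / F₀.firstEigenvalue p ∧
            F.firstEigenvalue p / F₀.firstEigenvalue p ≤ C ^ K := by
  refine ⟨p + 2 * n, by linarith [Nat.cast_nonneg (α := ℝ) n], ?_⟩
  intro M _ _ _ _ _ _ _ _ F F₀ C _ _ ⟨hC1, hC⟩
  have hC0 : 0 < C := one_pos.trans hC1
  have h : ∀ v, F v ≤ C * F₀ v := fun v => (hC v).2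
  have h₀ : ∀ v, F₀ v ≤ C * F v := fun v => (inv_mul_le_iff₀ hC0).1 (hC v).1
  have hpos := F₀.firstEigenvalue_pos hn hp
  constructor
  · rw [Real.rpow_neg hC0.le, le_div_iff₀ hpos, inv_mul_le_iff₀ (by positivity)]
    exact FinslerMetric.firstEigenvalue_le_mul hn hp hC0 h h₀
  · rw [div_le_iff₀ hpos]
    exact FinslerMetric.firstEigenvalue_le_mul hn hp hC0 h₀ h
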